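/- Let $\beta>0$, let $(h_i)_{i\ge 1}$ be i.i.d. real random variables with $\mathbb E h_1^2<\infty$ and $\mathbb E h_1^2\neq 0$, and let $$\mu_N(\sigma)=\frac{e^{-\beta H_N(\sigma)}}{\sum_{\sigma'\in\{-1,+1\}^N}e^{-\beta H_N(\sigma')}},\qquad H_N(\sigma)=-\frac1{2N}\sum_{i,j=1}^N\sigma_i\sigma_j-\sum_{i=1}^N h_i\sigma_i,\qquad \sigma\in\{-1,+1\}^N,$$ be the (random) Gibbs measure of the random field Curie–Weiss model. For $N\ge k$ let $\mu_{N,k}$ be the marginal distribution of the first $k$ spins under $\mu_N$. Put $$G(y)=-\frac{y^2}{2}+\mathbb E\bigl[\log\cosh(\sqrt\beta\,y+\beta h_1)\bigr],\qquad y\in\mathbb R.$$ Suppose that, for some $s\ge 1$, the global maximum points of $G$ are exactly the $s+1$ distinct points $y_0,\dots,y_s$, and that each of them is non-degenerate, i.e. $G'(y_j)=0$ and $G''(y_j)<0$. For $j=0,\dots,s$ and $k\in\mathbb N$ define the (random) product measure on $\{-1,+1\}^k$ $$\varrho^{(k)}_j(\sigma_1,\dots,\sigma_k)=\prod_{i=1}^k\frac{\exp\bigl(\sigma_i(\sqrt\beta\,y_j+\beta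 h_i)\bigr)}{2\cosh(\sqrt\beta\,y_j+\beta h_i)}.$$ Then for every fixed $k\in\mathbb N$ there are random indices $J_N=J_N^{(k)}(h_1,\dots,h_N)\in\{0,\dots,s\}$, $N\in\mathbb N$, each a measurable function of $(h_1,\dots,h_N)$, such that, as $N\to\infty$, $$\bigl|\mu_{N,k}(\sigma_1,\dots,\sigma_k)-\varrho^{(k)}_{J_N}(\sigma_1,\dots,\sigma_k)\bigr|\to0\quad\text{in probability, for all }(\sigma_1,\dots,\sigma_k)\in\{-1,+1\}^k,$$ and $$H\bigl(\mu_{N,k}\,\big|\,\varrho^{(k)}_{J_N}\bigr)\to0\quad\text{in probability,}$$ where $H(\mu|\nu)=\int\log\frac{d\mu}{d\nu}\,d\mu$ if $\mu\ll\nu$ and $H(\mu|\nu)=\infty$ otherwise denotes the relative entropy. -/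

import Mathlib

open MeasureTheory ProbabilityTheory Filter Topology
open scoped ENNReal

namespace RandomFieldCurieWeiss

/-- The two-point space of spins is discrete, so all sets of configurations are measurable. -/
instance : DiscreteMeasurableSpace ℤˣ :=
  ⟨fun t => ⟨Units.val '' t, MeasurableSet.of_discrete,
    Set.preimage_image_eq t Units.val_injective⟩⟩

/-- Configurations of `n` spins: `ℤˣ` is exactly the two-point set `{-1, +1}`. -/
abbrev Config (n : ℕ) : Type := Fin n → ℤˣ

/-- The real value `-1` or `+1` of a spin. -/
noncomputable def spin (s : ℤˣ) : ℝ := ((s : ℤ) : ℝ)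

/-- The Hamiltonian `H_N(σ) = -1/(2N) ∑_{i,j} σ_i σ_j - ∑_i h_i σ_i` for the fields
`h 0, …, h (N-1)`. -/
noncomputable def hamiltonian (h : ℕ → ℝ) (N : ℕ) (σ : Config N) : ℝ :=
  -(1 / (2 * (N : ℝ))) * ∑ i : Fin N, ∑ j : Fin N, spin (σ i) * spin (σ j)
    - ∑ i : Fin N, h i * spin (σ i)

/-- The partition function `Z_N`. -/
noncomputable def partitionFunction (β : ℝ) (h : ℕ → ℝ) (N : ℕ) : ℝ :=
  ∑ σ : Config N, Real.exp (-β * hamiltonian h N σ)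

/-- The Gibbs measure `μ_N`, as a mass function. -/
noncomputable def gibbs (β : ℝ) (h : ℕ → ℝ) (N : ℕ) (σ : Config N) : ℝ :=
  Real.exp (-β * hamiltonian h N σ) / partitionFunction β h N

/-- The first `k` spins of a configuration of `N ≥ k` spins. (If `N < k`, the missing spins are
filled up with `+1`; only `N → ∞` with `k` fixed matters.) -/
def firstSpins {N : ℕ} (k : ℕ) (σ : Config N) : Config k :=
  fun i => if hi : (i : ℕ) < N then σ ⟨i, hi⟩ else 1

/-- The marginal `μ_{N,k}` of the Gibbs measure on the first `k` spins, as a mass function. -/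
noncomputable def marginal (β : ℝ) (h : ℕ → ℝ) (N k : ℕ) (τ : Config k) : ℝ :=
  ∑ σ : Config N with firstSpins k σ = τ, gibbs β h N σ

/-- The product measure
`ϱ^{(k)}(σ) = ∏_{i ≤ k} exp(σ_i (√β y + β h_i)) / (2 cosh(√β y + β h_i))`, as a mass function. -/
noncomputable def productMass (β y : ℝ) (h : ℕ → ℝ) (k : ℕ) (τ : Config k) : ℝ :=
  ∏ i : Fin k, Real.exp (spin (τ i) * (√β * y + β * h i)) /
    (2 * Real.cosh (√β * y + β * h i))

/-- The measure on a finite space with mass function `p`. -/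
noncomputable def massMeasure {α : Type*} [Fintype α] [MeasurableSpace α] (p : α → ℝ) :
    Measure α :=
  ∑ a, ENNReal.ofReal (p a) • Measure.dirac a

/-- The function `G(y) = -y²/2 + 𝔼[log cosh(√β y + β X)]`, where `X` is a copy of the field. -/
noncomputable def freeEnergy {Ω : Type*} [MeasurableSpace Ω] (β : ℝ) (P : Measure Ω) (X : Ω → ℝ)
    (y : ℝ) : ℝ :=
  -(y ^ 2 / 2) + ∫ ω, Real.log (Real.cosh (√β * y + β * X ω)) ∂P

/-- `x` is a global maximum point of `f`. -/
def IsGlobalMax (f : ℝ → ℝ) (x : ℝ) : Prop := ∀ z, f z ≤ f x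

/-- The maximum point `x` of `f` is non-degenerate: `f'(x) = 0` and `f''(x) < 0`. -/
def IsNondegenerate (f : ℝ → ℝ) (x : ℝ) : Prop :=
  deriv f x = 0 ∧ deriv (deriv f) x < 0

end RandomFieldCurieWeiss

namespace RandomFieldCurieWeiss

/-! Writing the square in the Hamiltonian as a Gaussian integral (Hubbard–Stratonovich) decouples
the spins. So the marginal is a mixture over `y` of the product measures `productMass β y`, with
mixing density proportional to `exp (logDensity β h N y)` (`marginal_mul_integral`). By the law of
large numbers `logDensity / N` is close to `G`, and Laplace's method concentrates the mixing measure
near the maximum points of `G`.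

Fluctuations decide which of them wins. Since `G` takes the same value at all `y j`, the difference
of `logDensity` at two of them is a sum of centred i.i.d. variables. These do not vanish almost
surely: otherwise the field would be constant (`eq_of_logCosh_sub_eq`), non-zero by the second
moment, and `G` would have a single maximum point (`eq_of_isGlobalMax_of_const`). By the central
limit theorem the difference then exceeds any fixed `M` in absolute value with probability tending
to one (`tendsto_measure_abs_sum_le`).

At each `y j` the slope of `logDensity` is of order `√N` and its curvature of order `N`, so the true
local peak differs from the value at `y j` by a bounded amount only. Hence the highest of the
finitely many values takes almost all the mass (`setIntegral_exp_le_laplaceBound_mul`); `J N` is its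
index. Product masses are Lipschitz in `y`, which gives closeness of the mass functions. The
relative entropy is at most the `χ²`-distance (`klDiv_massMeasure_le`), whose denominators depend
only on the first `k` fields and so stay away from zero with high probability. -/

/-! ### Taylor bounds for `log cosh` and `tanh`. -/

/-- The logarithm of the hyperbolic cosine. -/
noncomputable def logCosh (x : ℝ) : ℝ := Real.log (Real.cosh x)

lemma hasDerivAt_logCosh (x : ℝ) : HasDerivAt logCosh (Real.tanh x) x := by
  have h := (Real.hasDerivAt_cosh x).log (Real.cosh_pos x).ne'
  rwa [← Real.tanh_eq_sinh_div_cosh] at h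

lemma hasDerivAt_tanh (x : ℝ) : HasDerivAt Real.tanh (1 - Real.tanh x ^ 2) x := by
  have h := (Real.hasDerivAt_sinh x).div (Real.hasDerivAt_cosh x) (Real.cosh_pos x).ne'
  have e : Real.tanh = fun x => Real.sinh x / Real.cosh x := by
    funext x; exact Real.tanh_eq_sinh_div_cosh x
  rw [e]
  convert! h using 1
  have := (Real.cosh_pos x).ne'
  field_simp

lemma continuous_logCosh : Continuous logCosh :=
  continuous_iff_continuousAt.2 fun x => (hasDerivAt_logCosh x).continuousAt

lemma continuous_tanh : Continuous Real.tanh :=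
  continuous_iff_continuousAt.2 fun x => (hasDerivAt_tanh x).continuousAt

lemma abs_logCosh_sub_le (x y : ℝ) : |logCosh x - logCosh y| ≤ |x - y| := by
  have := Convex.norm_image_sub_le_of_norm_hasDerivWithin_le (f := logCosh) (f' := Real.tanh)
    (C := 1) (s := Set.univ) (x := y) (y := x) (fun z _ => (hasDerivAt_logCosh z).hasDerivWithinAt)
    (fun z _ => (Real.abs_tanh_lt_one z).le) convex_univ trivial trivial
  simpa using this

lemma abs_tanh_sub_le (x y : ℝ) : |Real.tanh x - Real.tanh y| ≤ |x - y| := by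
  have := Convex.norm_image_sub_le_of_norm_hasDerivWithin_le (f := Real.tanh)
    (f' := fun z => 1 - Real.tanh z ^ 2)
    (C := 1) (s := Set.univ) (x := y) (y := x) (fun z _ => (hasDerivAt_tanh z).hasDerivWithinAt)
    (fun z _ => by
      have := Real.tanh_sq_lt_one z
      rw [Real.norm_eq_abs, abs_le]
      constructor <;> nlinarith [sq_nonneg (Real.tanh z)]) convex_univ trivial trivial
  simpa using this

lemma logCosh_neg (x : ℝ) : logCosh (-x) = logCosh x := by simp [logCosh]

lemma logCosh_zero : logCosh 0 = 0 := by simp [logCosh]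

lemma logCosh_nonneg (x : ℝ) : 0 ≤ logCosh x := Real.log_nonneg (Real.one_le_cosh x)

lemma logCosh_le_abs (x : ℝ) : logCosh x ≤ |x| := by
  have := abs_logCosh_sub_le x 0
  rw [logCosh_zero, sub_zero, sub_zero] at this
  exact (le_abs_self _).trans this

lemma exp_logCosh (x : ℝ) : Real.exp (logCosh x) = Real.cosh x := Real.exp_log (Real.cosh_pos x)

/-- A function which vanishes at `0` and is nondecreasing on `[0, ∞)` is nonnegative there. -/
lemma nonneg_of_hasDerivAt_nonneg {f f' : ℝ → ℝ} (hf : ∀ x, HasDerivAt f (f' x) x)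
    (h0 : f 0 = 0) (h' : ∀ x, 0 ≤ x → 0 ≤ f' x) {u : ℝ} (hu : 0 ≤ u) : 0 ≤ f u := by
  have hm : MonotoneOn f (Set.Ici 0) := by
    apply monotoneOn_of_deriv_nonneg (convex_Ici 0)
    · exact fun x _ => (hf x).continuousAt.continuousWithinAt
    · exact fun x _ => (hf x).differentiableAt.differentiableWithinAt
    · intro x hx
      rw [(hf x).deriv]
      rw [interior_Ici] at hx
      exact h' x (le_of_lt hx)
  have := hm (Set.mem_Ici.2 le_rfl) (Set.mem_Ici.2 hu) hu
  rwa [h0] at this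

/-- The remainder `u ^ 2` suffices because `tanh ^ 2` is 2-Lipschitz. -/
lemma tanh_le_taylor (x : ℝ) {u : ℝ} (hu : 0 ≤ u) :
    Real.tanh (x + u) ≤ Real.tanh x + (1 - Real.tanh x ^ 2) * u + u ^ 2 := by
  have key := nonneg_of_hasDerivAt_nonneg
    (f := fun u => Real.tanh x + (1 - Real.tanh x ^ 2) * u + u ^ 2 - Real.tanh (x + u))
    (f' := fun u => (1 - Real.tanh x ^ 2) + 2 * u - (1 - Real.tanh (x + u) ^ 2))
    (fun v => by
      have h1 := (hasDerivAt_tanh (x + v)).comp_const_add x v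
      have h2 := ((hasDerivAt_id v).const_mul (1 - Real.tanh x ^ 2)).const_add (Real.tanh x)
      have h3 := (h2.add (hasDerivAt_pow 2 v)).sub h1
      convert! h3 using 1
      simp)
    (by simp)
    (fun v hv => by
      have h1 := abs_le.1 (abs_tanh_sub_le (x + v) x)
      have h2 := Real.abs_tanh_lt_one x
      have h3 := Real.abs_tanh_lt_one (x + v)
      rw [abs_lt] at h2 h3
      rw [add_sub_cancel_left, abs_of_nonneg hv] at h1
      nlinarith)
    hu
  linarith

lemma logCosh_le_taylor_of_nonneg (x : ℝ) {u : ℝ} (hu : 0 ≤ u) :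
    logCosh (x + u) ≤
      logCosh x + Real.tanh x * u + (1 - Real.tanh x ^ 2) * (u ^ 2 / 2) + u ^ 3 / 3 := by
  have key := nonneg_of_hasDerivAt_nonneg
    (f := fun u => logCosh x + Real.tanh x * u + (1 - Real.tanh x ^ 2) * (u ^ 2 / 2) + u ^ 3 / 3
      - logCosh (x + u))
    (f' := fun u => Real.tanh x + (1 - Real.tanh x ^ 2) * u + u ^ 2 - Real.tanh (x + u))
    (fun v => by
      have h1 := (hasDerivAt_logCosh (x + v)).comp_const_add x v
      have h2 := ((hasDerivAt_id v).const_mul (Real.tanh x)).const_add (logCosh x)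
      have h4 := ((hasDerivAt_pow 2 v).div_const 2).const_mul (1 - Real.tanh x ^ 2)
      have h5 := (hasDerivAt_pow 3 v).div_const 3
      have h3 := ((h2.add h4).add h5).sub h1
      convert! h3 using 1
      simp)
    (by simp)
    (fun v hv => by have := tanh_le_taylor x hv; linarith)
    hu
  linarith

lemma logCosh_le_taylor (x u : ℝ) :
    logCosh (x + u) ≤
      logCosh x + Real.tanh x * u + (1 - Real.tanh x ^ 2) * (u ^ 2 / 2) + |u| ^ 3 := by
  have h3 : 0 ≤ |u| ^ 3 := by positivity
  rcases le_total 0 u with hu | hu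
  · have := logCosh_le_taylor_of_nonneg x hu
    rw [abs_of_nonneg hu] at h3 ⊢
    linarith
  · have := logCosh_le_taylor_of_nonneg (-x) (neg_nonneg.2 hu)
    rw [← neg_add, logCosh_neg, logCosh_neg, Real.tanh_neg] at this
    rw [abs_of_nonpos hu] at h3 ⊢
    nlinarith

lemma logCosh_tangent_le (x u : ℝ) : logCosh x + Real.tanh x * u ≤ logCosh (x + u) := by
  have aux : ∀ x u : ℝ, 0 ≤ u → logCosh x + Real.tanh x * u ≤ logCosh (x + u) := by
    intro x u hu
    have key := nonneg_of_hasDerivAt_nonneg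
      (f := fun u => logCosh (x + u) - (logCosh x + Real.tanh x * u))
      (f' := fun u => Real.tanh (x + u) - Real.tanh x)
      (fun v => by
        have h1 := (hasDerivAt_logCosh (x + v)).comp_const_add x v
        have h2 := ((hasDerivAt_id v).const_mul (Real.tanh x)).const_add (logCosh x)
        have h3 := h1.sub h2
        convert! h3 using 1
        simp)
      (by simp)
      (fun v hv => by
        have hm : Monotone Real.tanh := by
          apply monotone_of_deriv_nonneg fun z => (hasDerivAt_tanh z).differentiableAt
          intro z
          rw [(hasDerivAt_tanh z).deriv]
          linarith [Real.tanh_sq_lt_one z]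
        have := hm (show x ≤ x + v by linarith)
        linarith)
      hu
    linarith
  rcases le_total 0 u with hu | hu
  · exact aux x u hu
  · have := aux (-x) (-u) (neg_nonneg.2 hu)
    rw [← neg_add, logCosh_neg, logCosh_neg, Real.tanh_neg] at this
    linarith

/-- Translates of `log cosh` differ by an injective function. -/
lemma eq_of_logCosh_sub_eq {a b t t' : ℝ} (hab : a ≠ b)
    (h : logCosh (a + t) - logCosh (b + t) = logCosh (a + t') - logCosh (b + t')) : t = t' := by
  have h1 : Real.cosh (a + t) * Real.cosh (b + t') = Real.cosh (a + t') * Real.cosh (b + t) := by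
    rw [← exp_logCosh, ← exp_logCosh, ← exp_logCosh, ← exp_logCosh, ← Real.exp_add, ← Real.exp_add]
    congr 1; linarith
  -- Product-to-sum: the two sum terms share the argument `a + b + t + t'` and cancel, leaving equal
  -- `cosh` of `(a - b) ± (t - t')`.
  have prod : ∀ x y : ℝ, 2 * (Real.cosh x * Real.cosh y) = Real.cosh (x + y) + Real.cosh (x - y) := by
    intro x y; rw [Real.cosh_add, Real.cosh_sub]; ring
  have h2 : Real.cosh ((a + t) - (b + t')) = Real.cosh ((a + t') - (b + t)) := by
    have e1 := prod (a + t) (b + t')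
    have e2 := prod (a + t') (b + t)
    rw [show (a + t') + (b + t) = (a + t) + (b + t') by ring] at e2
    linarith
  have h3 := le_antisymm (Real.cosh_le_cosh.1 h2.le) (Real.cosh_le_cosh.1 h2.ge)
  rcases abs_eq_abs.1 h3 with h4 | h4
  · linarith
  · exact absurd (by linarith : a = b) hab

/-! ### Spins and product measures. -/

lemma spin_eq_one_or (s : ℤˣ) : spin s = 1 ∨ spin s = -1 := by
  rcases Int.units_eq_one_or s with rfl | rfl <;> simp [spin]

lemma abs_spin (s : ℤˣ) : |spin s| = 1 := by
  rcases spin_eq_one_or s with h | h <;> simp [h]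

lemma sum_exp_spin_mul (x : ℝ) : ∑ s : ℤˣ, Real.exp (spin s * x) / (2 * Real.cosh x) = 1 := by
  have hc := (Real.cosh_pos x).ne'
  rw [← Finset.sum_div, div_eq_one_iff_eq (by positivity), Real.cosh_eq]
  have : (Finset.univ : Finset ℤˣ) = {1, -1} := by decide
  rw [this, Finset.sum_pair (by decide)]
  simp [spin]
  ring

/-- The unnormalised log-density `-N y² / 2 + ∑_{i < N} log cosh(√β y + β h_i)` of the
Hubbard–Stratonovich mixing measure. -/
noncomputable def logDensity (β : ℝ) (h : ℕ → ℝ) (N : ℕ) (y : ℝ) : ℝ :=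
  -(N * (y ^ 2 / 2)) + ∑ i : Fin N, logCosh (√β * y + β * h i)

lemma productMass_pos (β y : ℝ) (h : ℕ → ℝ) (k : ℕ) (τ : Config k) :
    0 < productMass β y h k τ :=
  Finset.prod_pos fun i _ => div_pos (Real.exp_pos _) (by have := Real.cosh_pos (√β * y + β * h i); linarith)

lemma sum_productMass (β y : ℝ) (h : ℕ → ℝ) (k : ℕ) : ∑ τ, productMass β y h k τ = 1 := by
  unfold productMass
  have := Finset.prod_univ_sum (fun _ : Fin k => (Finset.univ : Finset ℤˣ))
    (fun i s => Real.exp (spin s * (√β * y + β * h i)) / (2 * Real.cosh (√β * y + β * h i)))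
  rw [Fintype.piFinset_univ] at this
  rw [← this]
  exact Finset.prod_eq_one fun i _ => sum_exp_spin_mul _

lemma productMass_le_one (β y : ℝ) (h : ℕ → ℝ) (k : ℕ) (τ : Config k) :
    productMass β y h k τ ≤ 1 := by
  rw [← sum_productMass β y h k]
  exact Finset.single_le_sum (f := fun τ => productMass β y h k τ)
    (fun τ _ => (productMass_pos β y h k τ).le) (Finset.mem_univ τ)

lemma productMass_eq_exp (β y : ℝ) (h : ℕ → ℝ) (k : ℕ) (τ : Config k) :
    productMass β y h k τ = Real.exp (∑ i : Fin k, (spin (τ i) * (√β * y + β * h i)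
      - logCosh (√β * y + β * h i) - Real.log 2)) := by
  rw [Real.exp_sum]
  refine Finset.prod_congr rfl fun i _ => ?_
  rw [Real.exp_sub, Real.exp_sub, exp_logCosh, Real.exp_log two_pos, div_div, mul_comm (2 : ℝ)]

lemma abs_exp_sub_exp_le {a b : ℝ} (ha : a ≤ 0) (hb : b ≤ 0) :
    |Real.exp a - Real.exp b| ≤ |a - b| := by
  have aux : ∀ a b : ℝ, a ≤ 0 → b ≤ a → |Real.exp a - Real.exp b| ≤ |a - b| := by
    intro a b ha hba
    rw [abs_of_nonneg (sub_nonneg.2 (Real.exp_le_exp.2 hba)), abs_of_nonneg (sub_nonneg.2 hba)]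
    have h1 : Real.exp b = Real.exp a * Real.exp (b - a) := by rw [← Real.exp_add]; ring_nf
    have h2 := Real.add_one_le_exp (b - a)
    have h3 := Real.exp_le_one_iff.2 ha
    have h4 := Real.exp_pos a
    rw [h1]
    nlinarith
  rcases le_total b a with h | h
  · exact aux a b ha h
  · rw [abs_sub_comm, abs_sub_comm a]; exact aux b a hb h

/-- Each site contributes a `2√β`-Lipschitz term to the log-mass, whatever the field, and `exp` is
1-Lipschitz on `(-∞, 0]`. -/
lemma abs_productMass_sub_le (β y z : ℝ) (h : ℕ → ℝ) (k : ℕ) (τ : Config k) :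
    |productMass β y h k τ - productMass β z h k τ| ≤ 2 * k * √β * |y - z| := by
  have h1 := productMass_le_one β y h k τ
  have h2 := productMass_le_one β z h k τ
  rw [productMass_eq_exp] at h1 h2 ⊢
  rw [productMass_eq_exp]
  refine (abs_exp_sub_exp_le (Real.exp_le_one_iff.1 h1) (Real.exp_le_one_iff.1 h2)).trans ?_
  rw [← Finset.sum_sub_distrib]
  refine (Finset.abs_sum_le_sum_abs _ _).trans ?_
  have : ∀ i ∈ (Finset.univ : Finset (Fin k)),
      |spin (τ i) * (√β * y + β * h i) - logCosh (√β * y + β * h i) - Real.log 2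
        - (spin (τ i) * (√β * z + β * h i) - logCosh (√β * z + β * h i) - Real.log 2)|
      ≤ 2 * √β * |y - z| := by
    intro i _
    have e1 : |spin (τ i) * (√β * (y - z))| = √β * |y - z| := by
      rw [abs_mul, abs_spin, one_mul, abs_mul, abs_of_nonneg (Real.sqrt_nonneg _)]
    have e2 : |logCosh (√β * z + β * h i) - logCosh (√β * y + β * h i)| ≤ √β * |y - z| := by
      refine (abs_logCosh_sub_le _ _).trans ?_
      rw [show √β * z + β * h i - (√β * y + β * h i) = √β * (z - y) by ring, abs_mul,
        abs_of_nonneg (Real.sqrt_nonneg _), abs_sub_comm]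
    rw [show spin (τ i) * (√β * y + β * h i) - logCosh (√β * y + β * h i) - Real.log 2
        - (spin (τ i) * (√β * z + β * h i) - logCosh (√β * z + β * h i) - Real.log 2)
        = spin (τ i) * (√β * (y - z)) + (logCosh (√β * z + β * h i) - logCosh (√β * y + β * h i))
        by ring]
    refine (abs_add_le _ _).trans ?_
    linarith
  refine (Finset.sum_le_sum this).trans (le_of_eq ?_)
  simp
  ring

/-- Bounds the denominators of the `χ²`-distance from below; the bound is random through the first
`k` fields. -/
lemma exp_neg_le_productMass (β y : ℝ) (h : ℕ → ℝ) (k : ℕ) (τ : Config k) :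
    Real.exp (-(∑ i : Fin k, (2 * (√β * |y| + |β| * |h i|) + Real.log 2)))
      ≤ productMass β y h k τ := by
  rw [productMass_eq_exp, Real.exp_le_exp, ← Finset.sum_neg_distrib]
  refine Finset.sum_le_sum fun i _ => ?_
  have h1 : |√β * y + β * h i| ≤ √β * |y| + |β| * |h i| := by
    refine (abs_add_le _ _).trans (le_of_eq ?_)
    rw [abs_mul, abs_mul, abs_of_nonneg (Real.sqrt_nonneg _)]
  have h2 := logCosh_le_abs (√β * y + β * h i)
  have h3 := neg_abs_le (spin (τ i) * (√β * y + β * h i))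
  rw [abs_mul, abs_spin, one_mul] at h3
  linarith

/-! ### The Hubbard–Stratonovich representation. -/

/-- Linearisation of the exponential of a square by a Gaussian integral. -/
lemma integrable_exp_linear {b : ℝ} (hb : 0 < b) (m : ℝ) :
    Integrable fun y : ℝ => Real.exp (-(b * (y ^ 2 / 2)) + m * y) := by
  have h := ((integrable_exp_neg_mul_sq (half_pos hb)).comp_sub_right (m / b)).const_mul
    (Real.exp (m ^ 2 / (2 * b)))
  refine h.congr (Eventually.of_forall fun y => ?_)
  simp only
  rw [← Real.exp_add]
  congr 1
  field_simp
  ring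

lemma integral_exp_linear {b : ℝ} (hb : 0 < b) (m : ℝ) :
    ∫ y : ℝ, Real.exp (-(b * (y ^ 2 / 2)) + m * y)
      = √(Real.pi / (b / 2)) * Real.exp (m ^ 2 / (2 * b)) := by
  have h : ∀ y : ℝ, Real.exp (-(b * (y ^ 2 / 2)) + m * y) =
      Real.exp (m ^ 2 / (2 * b)) * Real.exp (-(b / 2) * (y - m / b) ^ 2) := by
    intro y
    rw [← Real.exp_add]
    congr 1
    field_simp
    ring
  simp_rw [h]
  rw [integral_const_mul, integral_sub_right_eq_self fun y => Real.exp (-(b / 2) * y ^ 2),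
    integral_gaussian, mul_comm]

lemma neg_mul_hamiltonian {β : ℝ} (hβ : 0 ≤ β) (h : ℕ → ℝ) (N : ℕ) (σ : Config N) :
    -β * hamiltonian h N σ = (√β * ∑ i, spin (σ i)) ^ 2 / (2 * N)
      + ∑ i : Fin N, spin (σ i) * (β * h i) := by
  have h1 : ∑ i : Fin N, ∑ j : Fin N, spin (σ i) * spin (σ j) = (∑ i, spin (σ i)) ^ 2 := by
    rw [sq, Finset.sum_mul_sum]
  have h2 : ∑ i : Fin N, spin (σ i) * (β * h i) = β * ∑ i : Fin N, h i * spin (σ i) := by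
    rw [Finset.mul_sum]; exact Finset.sum_congr rfl fun i _ => by ring
  rw [hamiltonian, h1, h2, mul_pow, Real.sq_sqrt hβ]
  ring

/-- Once the square is linearised, the weight is a product over sites; normalising each site
releases a factor `2 cosh`, and these factors make up `2 ^ N * exp (logDensity)`. -/
lemma prod_exp_spin (β y : ℝ) (h : ℕ → ℝ) (N : ℕ) (σ : Config N) :
    Real.exp (-(N * (y ^ 2 / 2)) + (√β * ∑ i, spin (σ i)) * y)
        * Real.exp (∑ i : Fin N, spin (σ i) * (β * h i))
      = 2 ^ N * Real.exp (logDensity β h N y) * productMass β y h N σ := by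
  have h2 : (2 : ℝ) ^ N = Real.exp (∑ i : Fin N, Real.log 2) := by
    simp [Real.exp_nat_mul, Real.exp_log]
  rw [productMass_eq_exp, h2, logDensity, ← Real.exp_add, ← Real.exp_add, ← Real.exp_add,
    Finset.mul_sum, Finset.sum_mul, add_assoc, ← Finset.sum_add_distrib, add_left_comm, add_assoc,
    add_assoc]
  simp_rw [← Finset.sum_add_distrib]
  congr 2
  exact Finset.sum_congr rfl fun i _ => by ring

/-- The configurations with prescribed first spins form a product set, so the sum factorises and
every free site contributes 1. -/
lemma sum_productMass_firstSpins (β y : ℝ) (h : ℕ → ℝ) {N k : ℕ} (hkN : k ≤ N) (τ : Config k) :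
    ∑ σ : Config N with firstSpins k σ = τ, productMass β y h N σ = productMass β y h k τ := by
  have hset : (Finset.univ.filter fun σ : Config N => firstSpins k σ = τ)
      = Fintype.piFinset fun i : Fin N =>
        if hi : (i : ℕ) < k then {τ ⟨i, hi⟩} else (Finset.univ : Finset ℤˣ) := by
    ext σ
    simp only [Finset.mem_filter, Finset.mem_univ, true_and, Fintype.mem_piFinset]
    constructor
    · rintro rfl i
      split_ifs with hi
      · simp [firstSpins]
      · exact Finset.mem_univ _
    · intro H
      funext i
      have := H ⟨i, i.2.trans_le hkN⟩
      simp only [i.2, dif_pos, Finset.mem_singleton] at this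
      simp [firstSpins, i.2.trans_le hkN, this]
  rw [hset]
  unfold productMass
  rw [← Finset.prod_univ_sum _ (fun (i : Fin N) s =>
    Real.exp (spin s * (√β * y + β * h i)) / (2 * Real.cosh (√β * y + β * h i)))]
  obtain ⟨l, rfl⟩ := Nat.exists_eq_add_of_le hkN
  rw [Fin.prod_univ_add]
  have h1 : ∀ i : Fin l, (∑ s ∈ (if hi : ((Fin.natAdd k i : Fin (k + l)) : ℕ) < k then
      {τ ⟨(Fin.natAdd k i : Fin (k + l)), hi⟩} else (Finset.univ : Finset ℤˣ)),
      Real.exp (spin s * (√β * y + β * h (Fin.natAdd k i : Fin (k + l)))) /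
        (2 * Real.cosh (√β * y + β * h (Fin.natAdd k i : Fin (k + l))))) = 1 := by
    intro i
    rw [dif_neg (by simp)]
    exact sum_exp_spin_mul _
  rw [Finset.prod_congr rfl fun i _ => h1 i]
  simp

lemma exp_neg_mul_hamiltonian {β : ℝ} (hβ : 0 ≤ β) (h : ℕ → ℝ) {N : ℕ} (hN : 0 < N)
    (σ : Config N) :
    Integrable (fun y => Real.exp (logDensity β h N y) * productMass β y h N σ) ∧
    √(Real.pi / (N / 2)) * Real.exp (-β * hamiltonian h N σ) =
      2 ^ N * ∫ y, Real.exp (logDensity β h N y) * productMass β y h N σ := by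
  have hN' : (0 : ℝ) < N := Nat.cast_pos.2 hN
  have e : ∀ y, Real.exp (logDensity β h N y) * productMass β y h N σ
      = (Real.exp (∑ i : Fin N, spin (σ i) * (β * h i)) / 2 ^ N) *
        Real.exp (-(N * (y ^ 2 / 2)) + (√β * ∑ i, spin (σ i)) * y) := by
    intro y
    have := prod_exp_spin β y h N σ
    rw [div_mul_eq_mul_div, eq_div_iff (by positivity)]
    linarith
  simp_rw [e]
  refine ⟨(integrable_exp_linear hN' _).const_mul _, ?_⟩
  rw [integral_const_mul, integral_exp_linear hN', neg_mul_hamiltonian hβ, Real.exp_add]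
  generalize Real.exp (∑ i : Fin N, spin (σ i) * (β * h i)) = a
  field_simp

/-- The case `k = 0` represents the partition function with the same prefactors, which therefore
cancel in the Gibbs ratio. -/
lemma weight_eq_integral {β : ℝ} (hβ : 0 ≤ β) (h : ℕ → ℝ) {N k : ℕ} (hN : 0 < N) (hkN : k ≤ N)
    (τ : Config k) :
    Integrable (fun y => Real.exp (logDensity β h N y) * productMass β y h k τ) ∧
    √(Real.pi / (N / 2)) * ∑ σ : Config N with firstSpins k σ = τ,
        Real.exp (-β * hamiltonian h N σ) =
      2 ^ N * ∫ y, Real.exp (logDensity β h N y) * productMass β y h k τ := by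
  have e : ∀ y, Real.exp (logDensity β h N y) * productMass β y h k τ
      = ∑ σ : Config N with firstSpins k σ = τ,
        Real.exp (logDensity β h N y) * productMass β y h N σ := by
    intro y
    rw [← Finset.mul_sum, sum_productMass_firstSpins β y h hkN]
  simp_rw [e]
  refine ⟨integrable_finsetSum _ fun σ _ => (exp_neg_mul_hamiltonian hβ h hN σ).1, ?_⟩
  rw [integral_finsetSum _ fun σ _ => (exp_neg_mul_hamiltonian hβ h hN σ).1, Finset.mul_sum,
    Finset.mul_sum]
  exact Finset.sum_congr rfl fun σ _ => (exp_neg_mul_hamiltonian hβ h hN σ).2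

lemma productMass_zero (β y : ℝ) (h : ℕ → ℝ) (τ : Config 0) : productMass β y h 0 τ = 1 := by
  simp [productMass]

lemma integrable_exp_logDensity {β : ℝ} (hβ : 0 ≤ β) (h : ℕ → ℝ) {N : ℕ} (hN : 0 < N) :
    Integrable fun y => Real.exp (logDensity β h N y) := by
  simpa [productMass_zero] using (weight_eq_integral hβ h hN (Nat.zero_le N) default).1

lemma partitionFunction_eq_integral {β : ℝ} (hβ : 0 ≤ β) (h : ℕ → ℝ) {N : ℕ} (hN : 0 < N) :
    √(Real.pi / (N / 2)) * partitionFunction β h N =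
      2 ^ N * ∫ y, Real.exp (logDensity β h N y) := by
  have := (weight_eq_integral hβ h hN (Nat.zero_le N) default).2
  simp only [productMass_zero, mul_one] at this
  rw [← this, partitionFunction]
  congr 1
  refine Finset.sum_congr ?_ fun _ _ => rfl
  ext σ
  simp [Subsingleton.elim (firstSpins 0 σ) default]

lemma integral_exp_logDensity_pos {β : ℝ} (hβ : 0 ≤ β) (h : ℕ → ℝ) {N : ℕ} (hN : 0 < N) :
    0 < ∫ y, Real.exp (logDensity β h N y) :=
  integral_exp_pos (integrable_exp_logDensity hβ h hN)

/-- The marginals of the Gibbs measure are mixtures of product measures. -/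
theorem marginal_mul_integral {β : ℝ} (hβ : 0 ≤ β) (h : ℕ → ℝ) {N k : ℕ} (hN : 0 < N)
    (hkN : k ≤ N) (τ : Config k) :
    marginal β h N k τ * ∫ y, Real.exp (logDensity β h N y) =
      ∫ y, Real.exp (logDensity β h N y) * productMass β y h k τ := by
  have hN' : (0 : ℝ) < N := Nat.cast_pos.2 hN
  have hc : 0 < √(Real.pi / (N / 2)) := Real.sqrt_pos.2 (by positivity)
  have h1 := (weight_eq_integral hβ h hN hkN τ).2
  have h2 := partitionFunction_eq_integral hβ h hN
  have hZ : 0 < partitionFunction β h N :=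
    Finset.sum_pos (fun _ _ => Real.exp_pos _) Finset.univ_nonempty
  have h3 : marginal β h N k τ * partitionFunction β h N
      = ∑ σ : Config N with firstSpins k σ = τ, Real.exp (-β * hamiltonian h N σ) := by
    unfold marginal gibbs
    rw [← Finset.sum_div, div_mul_cancel₀ _ hZ.ne']
  rw [← h3] at h1
  have h4 : (0 : ℝ) < 2 ^ N := by positivity
  apply mul_left_cancel₀ h4.ne'
  rw [← h1, mul_left_comm, ← h2]
  ring

lemma marginal_nonneg (β : ℝ) (h : ℕ → ℝ) (N k : ℕ) (τ : Config k) :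
    0 ≤ marginal β h N k τ :=
  Finset.sum_nonneg fun _ _ => div_nonneg (Real.exp_pos _).le
    (Finset.sum_nonneg fun _ _ => (Real.exp_pos _).le)

/-! ### Laplace's method with several competing peaks. -/

/-- The bound of the Laplace method on the relative mass away from the dominant maximum. -/
noncomputable def laplaceBound (n : ℕ) (K c η M N : ℝ) : ℝ :=
  Real.exp (K + 1 / 2) / 2 * (n * Real.exp (-M + K ^ 2 / (2 * c)) * √(Real.pi / (c / 2))
    + Real.exp (-(N * η)) * √(Real.pi / η))

/-- On the window `|u| ≤ 1 / √N` the slope costs at most `K` and the quadratic term at most `1 / 2`.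
-/
lemma exp_lower_bound {F : ℝ → ℝ} (hF : Integrable fun x => Real.exp (F x)) {a N K : ℝ}
    (hN : 0 < N) (hK : 0 ≤ K)
    (lower : ∀ u, F a - K * √N * |u| - N * (u ^ 2 / 2) ≤ F (a + u)) :
    2 / √N * Real.exp (F a - (K + 1 / 2)) ≤ ∫ x, Real.exp (F x) := by
  have hs : 0 < √N := Real.sqrt_pos.2 hN
  have hss : √N * √N = N := Real.mul_self_sqrt hN.le
  have h1 : ∫ x in Set.Icc (a - 1 / √N) (a + 1 / √N), Real.exp (F a - (K + 1 / 2))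
      ≤ ∫ x in Set.Icc (a - 1 / √N) (a + 1 / √N), Real.exp (F x) := by
    refine setIntegral_mono_on (by simp) hF.integrableOn measurableSet_Icc fun x hx => ?_
    rw [Real.exp_le_exp]
    have hl := lower (x - a)
    rw [add_sub_cancel] at hl
    have habs : |x - a| ≤ 1 / √N := abs_le.2 ⟨by linarith [hx.1], by linarith [hx.2]⟩
    have h2 : √N * |x - a| ≤ 1 := by
      have := mul_le_mul_of_nonneg_left habs hs.le
      rwa [mul_one_div_cancel hs.ne'] at this
    have h3 : N * (x - a) ^ 2 ≤ 1 := by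
      rw [← sq_abs, ← hss]
      have : 0 ≤ √N * |x - a| := by positivity
      nlinarith
    have h4 : K * √N * |x - a| ≤ K := by rw [mul_assoc]; nlinarith
    linarith
  have h2 : ∫ x in Set.Icc (a - 1 / √N) (a + 1 / √N), Real.exp (F a - (K + 1 / 2))
      = 2 / √N * Real.exp (F a - (K + 1 / 2)) := by
    rw [setIntegral_const, smul_eq_mul, measureReal_def, Real.volume_Icc, ENNReal.toReal_ofReal]
    · ring
    · have : 0 < 1 / √N := by positivity
      linarith
  rw [← h2]
  exact h1.trans (setIntegral_le_integral hF (Eventually.of_forall fun _ => (Real.exp_pos _).le))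

/-- Laplace's method: if `F a` dominates the other peaks `F (y i)` by `M`, then most of the mass of
`exp F` lies close to `a = y J`. -/
theorem setIntegral_exp_le_laplaceBound_mul {ι : Type*} [Fintype ι] {F : ℝ → ℝ}
    (hF : Integrable fun x => Real.exp (F x)) (y : ι → ℝ) (J : ι) {N K c η r M : ℝ}
    (hN : 0 < N) (hK : 0 ≤ K) (hc : 0 < c) (hη : 0 < η)
    (lower : ∀ u, F (y J) - K * √N * |u| - N * (u ^ 2 / 2) ≤ F (y J + u))
    (upper : ∀ i u, |u| < r → F (y i + u) ≤ F (y i) + K * √N * |u| - c * N * u ^ 2)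
    (far : ∀ x, (∀ i, r ≤ |x - y i|) → F x ≤ F (y J) - N * η * (1 + x ^ 2))
    (gap : ∀ i, i ≠ J → F (y i) ≤ F (y J) - M) :
    ∫ x in {x | r ≤ |x - y J|}, Real.exp (F x)
      ≤ laplaceBound (Fintype.card ι) K c η M N * ∫ x, Real.exp (F x) := by
  have hs : 0 < √N := Real.sqrt_pos.2 hN
  have hss : √N * √N = N := Real.mul_self_sqrt hN.le
  have hb1 : 0 < c * N / 2 := by positivity
  have hb2 : 0 < N * η := by positivity
  -- The majorant has one Gaussian per peak and one for the far region. Each has mass of order `1 /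
  -- √N`, like the lower bound for the total mass, so `√N` drops out of the ratio.
  set g : ℝ → ℝ := fun x => Real.exp (F (y J)) *
    (∑ i, Real.exp (-M + K ^ 2 / (2 * c)) * Real.exp (-(c * N / 2) * (x - y i) ^ 2)
      + Real.exp (-(N * η)) * Real.exp (-(N * η) * x ^ 2)) with hg
  have hgi : ∀ i, Integrable fun x =>
      Real.exp (-M + K ^ 2 / (2 * c)) * Real.exp (-(c * N / 2) * (x - y i) ^ 2) := fun i =>
    ((integrable_exp_neg_mul_sq hb1).comp_sub_right (y i)).const_mul _
  have hgsum := integrable_finsetSum Finset.univ fun i _ => hgi i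
  have hgt := (integrable_exp_neg_mul_sq hb2).const_mul (Real.exp (-(N * η)))
  have hgint : Integrable g := (hgsum.add hgt).const_mul _
  have hgnn : ∀ x, 0 ≤ g x := fun x => by rw [hg]; positivity
  have hmeas : MeasurableSet {x | r ≤ |x - y J|} := by
    refine (isClosed_le continuous_const ?_).measurableSet
    fun_prop
  have hle : ∀ x ∈ {x | r ≤ |x - y J|}, Real.exp (F x) ≤ g x := by
    intro x hx
    by_cases hfar : ∀ i, r ≤ |x - y i|
    · refine (Real.exp_le_exp.2 (far x hfar)).trans ?_
      rw [sub_eq_add_neg, Real.exp_add]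
      refine mul_le_mul_of_nonneg_left ?_ (Real.exp_pos _).le
      rw [show -(N * η * (1 + x ^ 2)) = -(N * η) + -(N * η) * x ^ 2 by ring, Real.exp_add]
      exact le_add_of_nonneg_left (Finset.sum_nonneg fun i _ => by positivity)
    · push Not at hfar
      obtain ⟨i, hi⟩ := hfar
      -- The point is at distance at least `r` from `y J`, so the nearby peak is a different one and
      -- the gap `M` applies.
      have hiJ : i ≠ J := by
        rintro rfl
        exact absurd hx (not_le.2 hi)
      have h1 := upper i (x - y i) hi
      rw [add_sub_cancel] at h1
      have h2 := gap i hiJ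
      -- Completing the square: half of the quadratic decay absorbs the slope at the `N`-independent
      -- cost `K ^ 2 / (2 * c)`.
      have h3 : K * √N * |x - y i| ≤ c * N / 2 * (x - y i) ^ 2 + K ^ 2 / (2 * c) := by
        have e : c * N / 2 * (x - y i) ^ 2 + K ^ 2 / (2 * c) - K * √N * |x - y i|
            = (c * (√N * |x - y i|) - K) ^ 2 / (2 * c) := by
          rw [← sq_abs (x - y i), ← hss]
          have : √(√N * √N) = √N := by rw [hss]
          rw [this]
          field_simp
          ring
        have : 0 ≤ (c * (√N * |x - y i|) - K) ^ 2 / (2 * c) := by positivity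
        linarith
      have h4 : F x ≤ F (y J) + (-M + K ^ 2 / (2 * c) + -(c * N / 2) * (x - y i) ^ 2) := by
        linarith
      refine (Real.exp_le_exp.2 h4).trans ?_
      rw [Real.exp_add, Real.exp_add (-M + _)]
      refine mul_le_mul_of_nonneg_left ?_ (Real.exp_pos _).le
      refine le_add_of_le_of_nonneg ?_ (by positivity)
      exact Finset.single_le_sum (f := fun i => Real.exp (-M + K ^ 2 / (2 * c)) *
        Real.exp (-(c * N / 2) * (x - y i) ^ 2)) (fun i _ => by positivity) (Finset.mem_univ i)
  have hI : ∫ x, g x = Real.exp (F (y J)) / √N *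
      (Fintype.card ι * Real.exp (-M + K ^ 2 / (2 * c)) * √(Real.pi / (c / 2))
        + Real.exp (-(N * η)) * √(Real.pi / η)) := by
    rw [hg, integral_const_mul, integral_add hgsum hgt, integral_finsetSum _ fun i _ => hgi i]
    simp_rw [integral_const_mul]
    have e1 : ∀ i, ∫ x, Real.exp (-(c * N / 2) * (x - y i) ^ 2) = √(Real.pi / (c / 2)) / √N := by
      intro i
      rw [integral_sub_right_eq_self fun x => Real.exp (-(c * N / 2) * x ^ 2), integral_gaussian,
        ← Real.sqrt_div (by positivity)]
      congr 1
      field_simp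
    have e2 : ∫ x : ℝ, Real.exp (-(N * η) * x ^ 2) = √(Real.pi / η) / √N := by
      rw [integral_gaussian, ← Real.sqrt_div (by positivity)]
      congr 1
      field_simp
    simp_rw [e1, e2]
    rw [Finset.sum_const, Finset.card_univ, nsmul_eq_mul]
    ring
  have hlow := exp_lower_bound hF hN hK lower
  calc ∫ x in {x | r ≤ |x - y J|}, Real.exp (F x)
      ≤ ∫ x in {x | r ≤ |x - y J|}, g x :=
        setIntegral_mono_on hF.integrableOn hgint.integrableOn hmeas hle
    _ ≤ ∫ x, g x := setIntegral_le_integral hgint (Eventually.of_forall hgnn)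
    _ = laplaceBound (Fintype.card ι) K c η M N * (2 / √N * Real.exp (F (y J) - (K + 1 / 2))) := by
        rw [hI, laplaceBound, Real.exp_sub]
        field_simp
    _ ≤ _ := by
        refine mul_le_mul_of_nonneg_left hlow ?_
        unfold laplaceBound
        positivity

/-! ### From concentration of the mixing measure to the marginals. -/

/-- If the mixing measure concentrates at `a`, the marginal is close to the product measure with
parameter `a`. -/
theorem abs_marginal_sub_productMass_le {β : ℝ} (hβ : 0 ≤ β) (h : ℕ → ℝ) {N k : ℕ} (hN : 0 < N)
    (hkN : k ≤ N) (τ : Config k) (a : ℝ) {r B : ℝ} (hr : 0 ≤ r)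
    (hB : ∫ x in {x | r ≤ |x - a|}, Real.exp (logDensity β h N x)
      ≤ B * ∫ x, Real.exp (logDensity β h N x)) :
    |marginal β h N k τ - productMass β a h k τ| ≤ 2 * k * √β * r + B := by
  set Z := ∫ x, Real.exp (logDensity β h N x) with hZ
  have hZpos : 0 < Z := integral_exp_logDensity_pos hβ h hN
  have hint := integrable_exp_logDensity hβ h hN
  have hint' := (weight_eq_integral hβ h hN hkN τ).1
  have hmeas : MeasurableSet {x | r ≤ |x - a|} := by
    refine (isClosed_le continuous_const ?_).measurableSet
    fun_prop
  have h1 : (marginal β h N k τ - productMass β a h k τ) * Z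
      = ∫ x, Real.exp (logDensity β h N x) * (productMass β x h k τ - productMass β a h k τ) := by
    simp_rw [mul_sub]
    rw [integral_sub hint' (hint.mul_const _), integral_mul_const, ← hZ, sub_mul,
      marginal_mul_integral hβ h hN hkN τ]
    ring
  -- Within distance `r` of `a` the Lipschitz bound is used; beyond it, only that both masses lie in
  -- `[0, 1]`.
  have h2 : ∀ x, |Real.exp (logDensity β h N x) *
      (productMass β x h k τ - productMass β a h k τ)|
      ≤ (2 * k * √β * r) * Real.exp (logDensity β h N x)
        + {x | r ≤ |x - a|}.indicator (fun x => Real.exp (logDensity β h N x)) x := by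
    intro x
    have hp := Real.exp_pos (logDensity β h N x)
    rw [abs_mul, abs_of_pos hp]
    by_cases hx : r ≤ |x - a|
    · rw [Set.indicator_of_mem (show x ∈ {x | r ≤ |x - a|} from hx)]
      have : |productMass β x h k τ - productMass β a h k τ| ≤ 1 := by
        have e1 := productMass_pos β x h k τ
        have e2 := productMass_pos β a h k τ
        have e3 := productMass_le_one β x h k τ
        have e4 := productMass_le_one β a h k τ
        exact abs_le.2 ⟨by linarith, by linarith⟩
      have e5 : 0 ≤ 2 * k * √β * r * Real.exp (logDensity β h N x) := by positivity
      nlinarith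
    · rw [Set.indicator_of_notMem (show x ∉ {x | r ≤ |x - a|} from hx), add_zero]
      have e1 := abs_productMass_sub_le β x a h k τ
      have e2 : 2 * k * √β * |x - a| ≤ 2 * k * √β * r :=
        mul_le_mul_of_nonneg_left (not_le.1 hx).le (by positivity)
      nlinarith
  have h3 : |(marginal β h N k τ - productMass β a h k τ) * Z| ≤ (2 * k * √β * r + B) * Z := by
    rw [h1]
    refine (abs_integral_le_integral_abs).trans ?_
    have hi2 := hint.indicator hmeas
    refine (integral_mono_of_nonneg (Eventually.of_forall fun _ => abs_nonneg _)
      ((hint.const_mul (2 * k * √β * r)).add hi2) (Eventually.of_forall h2)).trans ?_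
    simp only [Pi.add_apply]
    rw [integral_add (hint.const_mul _) hi2, integral_const_mul, integral_indicator hmeas, ← hZ]
    linarith
  rw [abs_mul, abs_of_pos hZpos] at h3
  exact le_of_mul_le_mul_right h3 hZpos

/-! ### Relative entropy on a finite space. -/

section RelativeEntropy

variable {α : Type*} [Fintype α] [MeasurableSpace α]

instance isFiniteMeasure_massMeasure (p : α → ℝ) : IsFiniteMeasure (massMeasure p) := by
  constructor
  simp only [massMeasure, Measure.coe_finsetSum, Finset.sum_apply, Measure.smul_apply, smul_eq_mul]
  exact ENNReal.sum_lt_top.2 fun a _ => ENNReal.mul_lt_top ENNReal.ofReal_lt_top (measure_lt_top _ _)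

lemma lintegral_massMeasure [DiscreteMeasurableSpace α] (p : α → ℝ) (f : α → ℝ≥0∞) :
    ∫⁻ a, f a ∂(massMeasure p) = ∑ a, ENNReal.ofReal (p a) * f a := by
  simp [massMeasure, lintegral_finsetSum_measure, lintegral_smul_measure,
    lintegral_dirac' _ (Measurable.of_discrete (f := f))]

lemma massMeasure_eq_withDensity [DiscreteMeasurableSpace α] {p q : α → ℝ}
    (hq : ∀ a, 0 < q a) :
    massMeasure p = (massMeasure q).withDensity fun a => ENNReal.ofReal (p a / q a) := by
  ext t ht
  rw [withDensity_apply _ ht, ← lintegral_indicator ht, lintegral_massMeasure,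
    ← lintegral_indicator_one ht, lintegral_massMeasure]
  refine Finset.sum_congr rfl fun a _ => ?_
  by_cases ha : a ∈ t
  · simp only [Set.indicator_of_mem ha, Pi.one_apply, mul_one]
    rw [← ENNReal.ofReal_mul (hq a).le, mul_div_cancel₀ _ (hq a).ne']
  · simp [Set.indicator_of_notMem ha]

/-- Inserting `log x ≤ x - 1` into `x log x + 1 - x` gives exactly `(x - 1) ^ 2`. -/
lemma klFun_le_sq {x : ℝ} (hx : 0 ≤ x) : InformationTheory.klFun x ≤ (x - 1) ^ 2 := by
  rw [InformationTheory.klFun]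
  rcases hx.eq_or_lt with rfl | hx
  · simp
  · nlinarith [Real.log_le_sub_one_of_pos hx]

/-- The relative entropy is at most the `χ²`-distance. -/
theorem klDiv_massMeasure_le [DiscreteMeasurableSpace α] {p q : α → ℝ} (hp : ∀ a, 0 ≤ p a)
    (hq : ∀ a, 0 < q a) :
    InformationTheory.klDiv (massMeasure p) (massMeasure q)
      ≤ ENNReal.ofReal (∑ a, (p a - q a) ^ 2 / q a) := by
  have hwd := massMeasure_eq_withDensity (p := p) hq
  have hac : massMeasure p ≪ massMeasure q := by
    rw [hwd]; exact withDensity_absolutelyContinuous _ _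
  have hrn : (massMeasure p).rnDeriv (massMeasure q) =ᵐ[massMeasure q]
      fun a => ENNReal.ofReal (p a / q a) := by
    conv_lhs => rw [hwd]
    exact Measure.rnDeriv_withDensity _ Measurable.of_discrete
  rw [InformationTheory.klDiv_eq_lintegral_klFun_of_ac hac]
  have hcongr : ∫⁻ x, ENNReal.ofReal (InformationTheory.klFun
        ((massMeasure p).rnDeriv (massMeasure q) x).toReal) ∂(massMeasure q)
      = ∫⁻ x, ENNReal.ofReal (InformationTheory.klFun (p x / q x)) ∂(massMeasure q) := by
    refine lintegral_congr_ae (hrn.mono fun a ha => ?_)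
    simp only [ha]
    rw [ENNReal.toReal_ofReal (div_nonneg (hp a) (hq a).le)]
  rw [hcongr, lintegral_massMeasure,
    ENNReal.ofReal_sum_of_nonneg fun a _ => div_nonneg (sq_nonneg _) (hq a).le]
  refine Finset.sum_le_sum fun a _ => ?_
  rw [← ENNReal.ofReal_mul (hq a).le]
  refine ENNReal.ofReal_le_ofReal ?_
  have h1 := mul_le_mul_of_nonneg_left (klFun_le_sq (div_nonneg (hp a) (hq a).le)) (hq a).le
  refine h1.trans (le_of_eq ?_)
  have := (hq a).ne'
  field_simp

end RelativeEntropy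

/-! ### Limit theorems for i.i.d. sums. -/

section LimitTheorems

variable {Ω : Type*} [MeasurableSpace Ω] {P : Measure Ω} [IsProbabilityMeasure P]

/-- A distribution-free anti-concentration property of sums of centred i.i.d. variables. -/
theorem tendsto_measure_abs_sum_le {X : ℕ → Ω → ℝ} (hX : MemLp (X 0) 2 P)
    (hindep : iIndepFun X P) (hident : ∀ i, IdentDistrib (X i) (X 0) P P)
    (hmean : P[X 0] = 0) (hvar : Var[X 0; P] ≠ 0) (M : ℝ) :
    Tendsto (fun n : ℕ => P {ω | |∑ i ∈ Finset.range n, X i ω| ≤ M}) atTop (𝓝 0) := by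
  set v := Var[X 0; P].toNNReal with hv
  have hv0 : v ≠ 0 := by
    rw [hv, Ne, Real.toNNReal_eq_zero, not_le]
    exact lt_of_le_of_ne (variance_nonneg _ _) hvar.symm
  have hclt := tendstoInDistribution_inv_sqrt_mul_sum_sub (Y := id) (P' := gaussianReal 0 v)
    ⟨aemeasurable_id, Measure.map_id⟩ hX hindep hident
  have hmeas := hclt.forall_aemeasurable
  -- Non-zero variance enters here: the limiting Gaussian has no atom at 0, so small intervals
  -- around 0 have small mass.
  have hnull : Tendsto (fun δ : ℝ => gaussianReal 0 v (Set.Icc (-δ) δ)) (𝓝[>] 0) (𝓝 0) := by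
    have : NullSingletonClass (gaussianReal 0 v) := nullSingletonClass_gaussianReal hv0
    have h0 := tendsto_measure_biInter_gt (μ := gaussianReal 0 v)
      (s := fun δ : ℝ => Set.Icc (-δ) δ) (a := 0) (fun δ _ => measurableSet_Icc.nullMeasurableSet)
      (fun i j _ hij => Set.Icc_subset_Icc (neg_le_neg hij) hij)
      ⟨1, one_pos, measure_ne_top _ _⟩
    have hI : ⋂ δ > (0 : ℝ), Set.Icc (-δ) δ = {0} := by
      ext x
      simp only [Set.mem_iInter, Set.mem_Icc, Set.mem_singleton_iff]
      constructor
      · intro H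
        by_contra hx
        have := H (|x| / 2) (by positivity)
        have h2 := abs_le.2 this
        have h3 := abs_pos.2 hx
        linarith
      · rintro rfl δ hδ
        constructor <;> linarith
    rw [hI, measure_singleton] at h0
    exact h0
  rw [ENNReal.tendsto_nhds_zero]
  intro ε hε
  have h1 : ∀ᶠ δ in 𝓝[>] (0 : ℝ), gaussianReal 0 v (Set.Icc (-δ) δ) < ε :=
    hnull.eventually_lt_const hε
  obtain ⟨δ, hδε, hδ⟩ := (h1.and self_mem_nhdsWithin).exists
  have hδ : 0 < δ := hδ
  -- Portmanteau for a closed interval; after rescaling, the fixed level `M` falls below `δ * √n`.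
  have hlim := ProbabilityMeasure.limsup_measure_closed_le_of_tendsto hclt.tendsto
    (F := Set.Icc (-δ) δ) isClosed_Icc
  have hev : ∀ᶠ n : ℕ in atTop, P.map (fun ω => (√n)⁻¹ *
      (∑ k ∈ Finset.range n, X k ω - n * P[X 0])) (Set.Icc (-δ) δ) < ε := by
    refine eventually_lt_of_limsup_lt (lt_of_le_of_lt ?_ hδε)
    simpa using hlim
  have hbig : ∀ᶠ n : ℕ in atTop, M ≤ δ * √n ∧ 0 < √(n : ℝ) := by
    have ht : Tendsto (fun n : ℕ => √(n : ℝ)) atTop atTop :=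
      Real.tendsto_sqrt_atTop.comp tendsto_natCast_atTop_atTop
    exact ((ht.const_mul_atTop hδ).eventually_ge_atTop M).and (ht.eventually_gt_atTop 0)
  filter_upwards [hev, hbig] with n hn ⟨hM, hpos⟩
  refine le_trans ?_ hn.le
  rw [Measure.map_apply_of_aemeasurable (hmeas n) measurableSet_Icc]
  refine measure_mono fun ω hω => ?_
  have hω : |∑ i ∈ Finset.range n, X i ω| ≤ M := hω
  simp only [Set.mem_preimage, Set.mem_Icc, hmean, mul_zero, sub_zero]
  rw [← abs_le, abs_mul, abs_of_pos (inv_pos.2 hpos), inv_mul_le_iff₀ hpos]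
  linarith

/-- The weak law of large numbers for a function of i.i.d. variables. -/
theorem tendsto_measure_average {X : ℕ → Ω → ℝ} (hmeas : ∀ i, Measurable (X i))
    (hX : Integrable (X 0) P) (hindep : iIndepFun X P)
    (hident : ∀ i, IdentDistrib (X i) (X 0) P P) {δ : ℝ} (hδ : 0 < δ) :
    Tendsto (fun n : ℕ => P {ω | δ < |(∑ i ∈ Finset.range n, X i ω) / n - P[X 0]|})
      atTop (𝓝 0) := by
  have h1 := strong_law_ae_real X hX (fun i j hij => hindep.indepFun hij) hident
  have h2 : TendstoInMeasure P (fun (n : ℕ) ω => (∑ i ∈ Finset.range n, X i ω) / n) atTop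
      fun _ => P[X 0] := by
    refine tendstoInMeasure_of_tendsto_ae (fun n => ?_) h1
    refine Measurable.aestronglyMeasurable ?_
    have := hmeas
    fun_prop
  have h3 := h2 (ENNReal.ofReal δ) (ENNReal.ofReal_pos.2 hδ)
  refine tendsto_of_tendsto_of_tendsto_of_le_of_le tendsto_const_nhds h3 (fun _ => zero_le)
    fun n => measure_mono fun ω hω => ?_
  have hω : δ < |(∑ i ∈ Finset.range n, X i ω) / n - P[X 0]| := hω
  change ENNReal.ofReal δ ≤ edist _ _
  rw [edist_dist, Real.dist_eq]
  exact ENNReal.ofReal_le_ofReal hω.le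

/-- Chebyshev's inequality on the scale `√n`. -/
theorem measure_abs_sum_gt_le {X : ℕ → Ω → ℝ} (hX : MemLp (X 0) 2 P)
    (hindep : iIndepFun X P) (hident : ∀ i, IdentDistrib (X i) (X 0) P P)
    (hmean : P[X 0] = 0) {K : ℝ} (hK : 0 < K) {n : ℕ} (hn : 0 < n) :
    P {ω | K * √n < |∑ i ∈ Finset.range n, X i ω|} ≤ ENNReal.ofReal (Var[X 0; P] / K ^ 2) := by
  have hL : ∀ i, MemLp (X i) 2 P := fun i => (hident i).memLp_iff.2 hX
  have hn' : (0 : ℝ) < n := Nat.cast_pos.2 hn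
  have hc : 0 < K * √n := by positivity
  have h1 := meas_ge_le_variance_div_sq (memLp_finsetSum (Finset.range n) fun i _ => hL i) hc
  have hE : P[fun ω => ∑ i ∈ Finset.range n, X i ω] = 0 := by
    rw [integral_finsetSum _ fun i _ => (hL i).integrable one_le_two]
    exact Finset.sum_eq_zero fun i _ => by rw [(hident i).integral_eq, hmean]
  have hV : Var[fun ω => ∑ i ∈ Finset.range n, X i ω; P] = n * Var[X 0; P] := by
    have := IndepFun.variance_sum (s := Finset.range n) (X := X) (μ := P) (fun i _ => hL i)
      (fun i _ j _ hij => hindep.indepFun hij)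
    rw [← Finset.sum_fn]
    rw [this, Finset.sum_congr rfl fun i _ => (hident i).variance_eq]
    simp
  rw [hE, hV, mul_pow, Real.sq_sqrt hn'.le] at h1
  refine (measure_mono fun ω hω => ?_).trans (h1.trans (le_of_eq ?_))
  · have hω : K * √n < |∑ i ∈ Finset.range n, X i ω| := hω
    simpa using hω.le
  · congr 1
    field_simp

end LimitTheorems

/-! ### Uniqueness of the maximum point in a constant non-zero field. -/

section ConstantField

lemma tanh_monotone : Monotone Real.tanh := by
  apply monotone_of_deriv_nonneg fun z => (hasDerivAt_tanh z).differentiableAt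
  intro z
  rw [(hasDerivAt_tanh z).deriv]
  linarith [Real.tanh_sq_lt_one z]

lemma tanh_add_le {u w : ℝ} (hu : 0 ≤ u) (hw : 0 ≤ w) :
    Real.tanh (u + w) ≤ Real.tanh u + (1 - Real.tanh u ^ 2) * w := by
  have key := nonneg_of_hasDerivAt_nonneg
    (f := fun w => Real.tanh u + (1 - Real.tanh u ^ 2) * w - Real.tanh (u + w))
    (f' := fun w => (1 - Real.tanh u ^ 2) - (1 - Real.tanh (u + w) ^ 2))
    (fun v => by
      have h1 := (hasDerivAt_tanh (u + v)).comp_const_add u v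
      have h2 := ((hasDerivAt_id v).const_mul (1 - Real.tanh u ^ 2)).const_add (Real.tanh u)
      convert! h2.sub h1 using 1
      simp)
    (by simp)
    (fun v hv => by
      have h0 : 0 ≤ Real.tanh u := by simpa using tanh_monotone hu
      have h1 := tanh_monotone (show u ≤ u + v by linarith)
      nlinarith)
    hw
  linarith

lemma mul_one_sub_tanh_sq_le {u : ℝ} (hu : 0 ≤ u) : u * (1 - Real.tanh u ^ 2) ≤ Real.tanh u := by
  have hc := Real.cosh_pos u
  have h1 : 1 - Real.tanh u ^ 2 = 1 / Real.cosh u ^ 2 := by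
    rw [Real.tanh_eq_sinh_div_cosh]
    have := Real.cosh_sq u
    field_simp
    linarith
  have h2 := Real.self_le_sinh_iff.2 hu
  have h3 := Real.one_le_cosh u
  rw [h1, Real.tanh_eq_sinh_div_cosh, mul_one_div, div_le_div_iff₀ (by positivity) hc]
  have h4 : u ≤ Real.sinh u * Real.cosh u := by nlinarith
  nlinarith

/-- Concavity of `tanh` on `[0, ∞)` turns two fixed points into `β (1 - tanh² u) ≥ 1` at the smaller
one. But `u (1 - tanh² u) ≤ tanh u`, while `u = β tanh u + β c > β tanh u`. -/
lemma not_two_fixedPoints {β c a b : ℝ} (hβ : 0 < β) (hc : 0 < c) (ha0 : 0 ≤ a) (hab : a < b)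
    (ha : a = √β * Real.tanh (√β * a + β * c)) (hb : b = √β * Real.tanh (√β * b + β * c)) :
    False := by
  have hs : 0 < √β := Real.sqrt_pos.2 hβ
  have hss := Real.mul_self_sqrt hβ.le
  set u := √β * a + β * c with hu
  have hupos : 0 < u := by positivity
  have hw : 0 < √β * (b - a) := mul_pos hs (sub_pos.2 hab)
  have h1 := tanh_add_le hupos.le hw.le
  rw [show u + √β * (b - a) = √β * b + β * c by rw [hu]; ring] at h1
  have h2 : b - a ≤ (1 - Real.tanh u ^ 2) * (β * (b - a)) := by
    have := mul_le_mul_of_nonneg_left h1 hs.le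
    rw [← hb, mul_add, ← ha] at this
    rw [← hss]
    linarith
  have h3 : 1 ≤ (1 - Real.tanh u ^ 2) * β := by
    have : 0 < b - a := sub_pos.2 hab
    by_contra hlt
    push Not at hlt
    nlinarith
  have h4 := mul_one_sub_tanh_sq_le hupos.le
  have h5 : u = β * Real.tanh u + β * c := by
    have : √β * a = β * Real.tanh u := by
      conv_lhs => rw [ha]
      rw [← mul_assoc, hss]
    linarith
  nlinarith [mul_pos hβ hc]

/-- In a constant non-zero field the free energy has a unique maximum point. -/
lemma eq_of_isGlobalMax_of_const {β c a b : ℝ} (hβ : 0 < β) (hc : c ≠ 0)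
    (ha : IsGlobalMax (fun y => -(y ^ 2 / 2) + logCosh (√β * y + β * c)) a)
    (hb : IsGlobalMax (fun y => -(y ^ 2 / 2) + logCosh (√β * y + β * c)) b) : a = b := by
  have hs : 0 < √β := Real.sqrt_pos.2 hβ
  have crit : ∀ c x : ℝ, IsGlobalMax (fun y => -(y ^ 2 / 2) + logCosh (√β * y + β * c)) x →
      x = √β * Real.tanh (√β * x + β * c) := by
    intro c x hx
    have h1 : HasDerivAt (fun y : ℝ => -(y ^ 2 / 2)) (-x) x := by
      convert! ((hasDerivAt_pow 2 x).div_const 2).neg using 1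
      simp
    have h2 := (hasDerivAt_logCosh (√β * x + β * c)).comp x
      (((hasDerivAt_id x).const_mul (√β)).add_const (β * c))
    have hloc : IsLocalMax (fun y => -(y ^ 2 / 2) + logCosh (√β * y + β * c)) x :=
      Eventually.of_forall hx
    have := hloc.hasDerivAt_eq_zero (h1.add h2)
    simp only [mul_one] at this
    linarith
  -- Comparing `x` with its reflection `-x`: a positive field favours nonnegative `x`.
  have pos : ∀ c x : ℝ, 0 < c →
      IsGlobalMax (fun y => -(y ^ 2 / 2) + logCosh (√β * y + β * c)) x → 0 ≤ x := by
    intro c x hc hx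
    have h1 := hx (-x)
    simp only [neg_sq, add_le_add_iff_left, logCosh] at h1
    rw [Real.log_le_log_iff (Real.cosh_pos _) (Real.cosh_pos _), Real.cosh_le_cosh, ← sq_le_sq] at h1
    have h2 : 0 ≤ (√β * β * c) * x := by nlinarith
    exact nonneg_of_mul_nonneg_right h2 (by positivity)
  have main : ∀ c a b : ℝ, 0 < c →
      IsGlobalMax (fun y => -(y ^ 2 / 2) + logCosh (√β * y + β * c)) a →
      IsGlobalMax (fun y => -(y ^ 2 / 2) + logCosh (√β * y + β * c)) b → a = b := by
    intro c a b hc ha hb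
    rcases lt_trichotomy a b with h | h | h
    · exact (not_two_fixedPoints hβ hc (pos c a hc ha) h (crit c a ha) (crit c b hb)).elim
    · exact h
    · exact (not_two_fixedPoints hβ hc (pos c b hc hb) h (crit c b hb) (crit c a ha)).elim
  rcases hc.lt_or_gt with hneg | hpos
  · have flip : ∀ x, IsGlobalMax (fun y => -(y ^ 2 / 2) + logCosh (√β * y + β * c)) x →
        IsGlobalMax (fun y => -(y ^ 2 / 2) + logCosh (√β * y + β * -c)) (-x) := by
      intro x hx z
      have := hx (-z)
      simp only [neg_sq] at this ⊢
      rw [← logCosh_neg (√β * z + β * -c), ← logCosh_neg (√β * -x + β * -c)]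
      convert! this using 3
      · ring
      · ring
    exact neg_injective (main (-c) (-a) (-b) (neg_pos.2 hneg) (flip a ha) (flip b hb))
  · exact main c a b hpos ha hb

end ConstantField

/-! ### Regularity and maxima of the free energy. -/

section FreeEnergy

variable {Ω : Type*} [MeasurableSpace Ω] {P : Measure Ω} [IsProbabilityMeasure P]
  {β : ℝ} {X : Ω → ℝ}

lemma integrable_logCosh (β : ℝ) (hX : Integrable X P) (y : ℝ) :
    Integrable (fun ω => logCosh (√β * y + β * X ω)) P := by
  have hl : Integrable (fun ω => |√β * y + β * X ω|) P :=
    ((integrable_const _).add (hX.const_mul β)).abs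
  refine hl.mono' (continuous_logCosh.comp_aestronglyMeasurable
    ((hX.aestronglyMeasurable.const_mul β).const_add _)) (Eventually.of_forall fun ω => ?_)
  rw [Real.norm_eq_abs, abs_of_nonneg (logCosh_nonneg _)]
  exact logCosh_le_abs _

omit [IsProbabilityMeasure P] in
lemma aestronglyMeasurable_tanh (β : ℝ) (hX : AEStronglyMeasurable X P) (y : ℝ) :
    AEStronglyMeasurable (fun ω => Real.tanh (√β * y + β * X ω)) P :=
  continuous_tanh.comp_aestronglyMeasurable ((hX.const_mul β).const_add _)

/-- With this formula, `G'(y j) = 0` says that the slope variables `√β tanh(√β y j + β h i) - y j`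
are centred. -/
lemma hasDerivAt_freeEnergy (hX : Integrable X P) (y : ℝ) :
    HasDerivAt (freeEnergy β P X) (-y + ∫ ω, √β * Real.tanh (√β * y + β * X ω) ∂P) y := by
  have h1 : HasDerivAt (fun y : ℝ => -(y ^ 2 / 2)) (-y) y := by
    convert! ((hasDerivAt_pow 2 y).div_const 2).neg using 1
    simp
  have h2 := (hasDerivAt_integral_of_dominated_loc_of_deriv_le (μ := P) (x₀ := y)
    (F := fun y ω => logCosh (√β * y + β * X ω))
    (F' := fun y ω => √β * Real.tanh (√β * y + β * X ω)) (bound := fun _ => √β) univ_mem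
    (Eventually.of_forall fun y => (integrable_logCosh β hX y).aestronglyMeasurable)
    (integrable_logCosh β hX y)
    ((aestronglyMeasurable_tanh β hX.aestronglyMeasurable y).const_mul _)
    (Eventually.of_forall fun ω z _ => by
      rw [norm_mul, Real.norm_eq_abs, Real.norm_eq_abs, abs_of_nonneg (Real.sqrt_nonneg β)]
      exact mul_le_of_le_one_right (Real.sqrt_nonneg β) (Real.abs_tanh_lt_one _).le)
    (integrable_const _)
    (Eventually.of_forall fun ω z _ => by
      have e := (hasDerivAt_logCosh (√β * z + β * X ω)).comp z
        (((hasDerivAt_id z).const_mul (√β)).add_const (β * X ω))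
      convert! e using 1
      simp [mul_comm])).2
  exact h1.add h2

/-- With this formula, `G''(y j) < 0` says that the mean of `β (1 - tanh²)` at `y j` is below 1. -/
lemma hasDerivAt_deriv_freeEnergy (hβ : 0 ≤ β) (hX : Integrable X P) (y : ℝ) :
    HasDerivAt (deriv (freeEnergy β P X))
      (-1 + ∫ ω, β * (1 - Real.tanh (√β * y + β * X ω) ^ 2) ∂P) y := by
  have hd : deriv (freeEnergy β P X)
      = fun y => -y + ∫ ω, √β * Real.tanh (√β * y + β * X ω) ∂P :=
    funext fun y => (hasDerivAt_freeEnergy hX y).deriv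
  rw [hd]
  have hb : ∀ z, ‖Real.tanh z‖ ≤ 1 := fun z => (Real.abs_tanh_lt_one _).le
  have hm := fun y => aestronglyMeasurable_tanh β hX.aestronglyMeasurable (P := P) y
  have h2 := (hasDerivAt_integral_of_dominated_loc_of_deriv_le (μ := P) (x₀ := y)
    (F := fun y ω => √β * Real.tanh (√β * y + β * X ω))
    (F' := fun y ω => β * (1 - Real.tanh (√β * y + β * X ω) ^ 2)) (bound := fun _ => β) univ_mem
    (Eventually.of_forall fun y => (hm y).const_mul _)
    ((Integrable.of_bound (hm y) 1 (Eventually.of_forall fun ω => hb _)).const_mul _)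
    ((aestronglyMeasurable_const.sub ((hm y).pow 2)).const_mul β)
    (Eventually.of_forall fun ω z _ => by
      have h1 := Real.tanh_sq_lt_one (√β * z + β * X ω)
      have h2 := sq_nonneg (Real.tanh (√β * z + β * X ω))
      rw [norm_mul, Real.norm_eq_abs, Real.norm_eq_abs, abs_of_nonneg hβ,
        abs_of_pos (sub_pos.2 h1)]
      exact mul_le_of_le_one_right hβ (by linarith))
    (integrable_const _)
    (Eventually.of_forall fun ω z _ => by
      have e := ((hasDerivAt_tanh (√β * z + β * X ω)).comp z
        (((hasDerivAt_id z).const_mul (√β)).add_const (β * X ω))).const_mul (√β)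
      convert! e using 1
      have := Real.mul_self_sqrt hβ
      simp only [mul_one]
      linear_combination -(1 - Real.tanh (√β * z + β * X ω) ^ 2) * this)).2
  exact (hasDerivAt_id y).neg.add h2

lemma continuous_freeEnergy (hX : Integrable X P) : Continuous (freeEnergy β P X) :=
  continuous_iff_continuousAt.2 fun y => (hasDerivAt_freeEnergy hX y).continuousAt

lemma freeEnergy_le (hβ : 0 ≤ β) (hX : Integrable X P) (y : ℝ) :
    freeEnergy β P X y ≤ -(y ^ 2 / 2) + √β * |y| + β * ∫ ω, |X ω| ∂P := by
  have h1 : ∫ ω, logCosh (√β * y + β * X ω) ∂P ≤ ∫ ω, (√β * |y| + β * |X ω|) ∂P := by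
    refine integral_mono (integrable_logCosh β hX y)
      ((integrable_const _).add (hX.abs.const_mul β)) fun ω => ?_
    refine (logCosh_le_abs _).trans ((abs_add_le _ _).trans (le_of_eq ?_))
    rw [abs_mul, abs_mul, abs_of_nonneg (Real.sqrt_nonneg _), abs_of_nonneg hβ]
  rw [integral_add (integrable_const _) (hX.abs.const_mul β), integral_const,
    probReal_univ, one_smul, integral_const_mul] at h1
  change -(y ^ 2 / 2) + ∫ ω, logCosh (√β * y + β * X ω) ∂P ≤ _
  linarith

/-- Away from its maximum points, the free energy stays below its maximum, with a quadratic
margin. -/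
lemma exists_freeEnergy_le_sub (hβ : 0 ≤ β) (hX : Integrable X P) {ι : Type*} [Nonempty ι]
    {y : ι → ℝ} (y_max : ∀ x : ℝ, IsGlobalMax (freeEnergy β P X) x ↔ ∃ j, y j = x)
    {r : ℝ} (hr : 0 < r) :
    ∃ η > 0, ∀ j x, (∀ i, r ≤ |x - y i|) →
      freeEnergy β P X x ≤ freeEnergy β P X (y j) - η * (1 + x ^ 2) := by
  obtain ⟨j₀⟩ := ‹Nonempty ι›
  set G := freeEnergy β P X
  have hmaxj : ∀ j, IsGlobalMax G (y j) := fun j => (y_max _).2 ⟨j, rfl⟩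
  set C := β * ∫ ω, |X ω| ∂P - G (y j₀)
  -- For `|x| ≥ R` one has `√β |x| ≤ x² / 4` and `C ≤ (x² - 1) / 8`, so the decay `-x² / 2` leaves
  -- the margin `(1 + x²) / 8`.
  set R := 4 * √β + 8 * |C| + 2 with hR
  have hRpos : 2 ≤ R := by have := Real.sqrt_nonneg β; have := abs_nonneg C; linarith
  have htail : ∀ x, R ≤ |x| → G x ≤ G (y j₀) - 1 / 8 * (1 + x ^ 2) := by
    intro x hx
    have h1 := freeEnergy_le hβ hX x
    have h2 : 4 * √β * |x| ≤ x ^ 2 := by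
      rw [← sq_abs x]
      have := abs_nonneg C
      nlinarith [abs_nonneg x]
    have h3 : 8 * C + 1 ≤ x ^ 2 := by
      rw [← sq_abs x]
      have := le_abs_self C
      have := Real.sqrt_nonneg β
      nlinarith [abs_nonneg x]
    have h4 : β * ∫ ω, |X ω| ∂P = C + G (y j₀) := by ring
    rw [h4] at h1
    linarith
  set S : Set ℝ := Set.Icc (-R) R ∩ ⋂ i, {x | r ≤ |x - y i|} with hS
  have hScpt : IsCompact S := by
    refine isCompact_Icc.inter_right (isClosed_iInter fun i => isClosed_le continuous_const ?_)
    fun_prop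
  have hcont : Continuous G := continuous_freeEnergy hX
  -- A maximum over the compact set `S` reaching the global value would sit at some `y i`, but `S`
  -- avoids these.
  obtain ⟨d, hd, hdS⟩ : ∃ d > 0, ∀ x ∈ S, G x ≤ G (y j₀) - d := by
    rcases S.eq_empty_or_nonempty with hE | hne
    · exact ⟨1, one_pos, fun x hx => by rw [hE] at hx; exact hx.elim⟩
    · obtain ⟨x₀, hx₀, hx₀max⟩ := hScpt.exists_isMaxOn hne hcont.continuousOn
      refine ⟨G (y j₀) - G x₀, ?_, fun x hx => by have := hx₀max hx; simp at this; linarith⟩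
      by_contra hle
      have hle : G (y j₀) ≤ G x₀ := by linarith
      obtain ⟨i, hi⟩ := (y_max x₀).1 fun z => (hmaxj j₀ z).trans hle
      have := Set.mem_iInter.1 hx₀.2 i
      simp only [Set.mem_ofPred_eq, hi, sub_self, abs_zero] at this
      linarith
  refine ⟨min (1 / 8) (d / (1 + R ^ 2)), lt_min (by norm_num) (by positivity), ?_⟩
  intro j x hx
  rw [le_antisymm (hmaxj j₀ (y j)) (hmaxj j (y j₀))]
  rcases le_total R |x| with hxR | hxR
  · have := mul_le_mul_of_nonneg_right (min_le_left (1 / 8) (d / (1 + R ^ 2)))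
      (by positivity : (0 : ℝ) ≤ 1 + x ^ 2)
    linarith [htail x hxR]
  · have h1 := hdS x ⟨abs_le.1 hxR, Set.mem_iInter.2 hx⟩
    have h2 : x ^ 2 ≤ R ^ 2 := by rw [← sq_abs]; exact pow_le_pow_left₀ (abs_nonneg x) hxR 2
    have h3 := mul_le_mul (min_le_right (1 / 8) (d / (1 + R ^ 2)))
      (by linarith : 1 + x ^ 2 ≤ 1 + R ^ 2) (by positivity) (by positivity)
    rw [div_mul_cancel₀ _ (by positivity)] at h3
    linarith

/-- If the fields are not almost surely zero, the difference of the local contributions of two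
distinct maximum points is not almost surely constant. -/
lemma not_ae_logCosh_sub_eq (hβ : 0 < β) (h_ne : ∫ ω, X ω ^ 2 ∂P ≠ 0) {a b : ℝ} (hab : a ≠ b)
    (ha : IsGlobalMax (freeEnergy β P X) a) (hb : IsGlobalMax (freeEnergy β P X) b) (d : ℝ) :
    ¬ ∀ᵐ ω ∂P, logCosh (√β * a + β * X ω) - logCosh (√β * b + β * X ω) = d := by
  intro hae
  have hs : 0 < √β := Real.sqrt_pos.2 hβ
  have hab' : √β * a ≠ √β * b := fun h => hab (mul_left_cancel₀ hs.ne' h)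
  obtain ⟨ω₀, hω₀⟩ := hae.exists
  -- A constant difference forces a constant field, which reduces to the explicit one-field free
  -- energy.
  have hconst : ∀ᵐ ω ∂P, X ω = X ω₀ := by
    filter_upwards [hae] with ω hω
    exact mul_left_cancel₀ hβ.ne' (eq_of_logCosh_sub_eq hab' (hω.trans hω₀.symm))
  set c := X ω₀
  have hG : freeEnergy β P X = fun y => -(y ^ 2 / 2) + logCosh (√β * y + β * c) := by
    funext y
    rw [freeEnergy, integral_congr_ae (g := fun _ => logCosh (√β * y + β * c))
      (hconst.mono fun ω hω => by simp only [hω]; rfl)]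
    simp
  have hc : c ≠ 0 := by
    intro hc
    apply h_ne
    rw [integral_congr_ae (g := fun _ => (0 : ℝ)) (hconst.mono fun ω hω => by simp [hω, hc])]
    simp
  rw [hG] at ha hb
  exact hab (eq_of_isGlobalMax_of_const hβ hc ha hb)

end FreeEnergy

/-! ### Reduction of a uniform estimate to finitely many points. -/

section Net

/-- A Lipschitz function which is small on a suitable finite set is small everywhere, relative to
`1 + x²`. -/
lemma exists_finset_abs_le {L η : ℝ} (hL : 0 ≤ L) (hη : 0 < η) :
    ∃ T : Finset ℝ, ∀ D : ℝ → ℝ, (∀ x z, |D x - D z| ≤ L * |x - z|) →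
      (∀ z ∈ T, |D z| ≤ η / 2) → ∀ x, |D x| ≤ η * (1 + x ^ 2) := by
  have hρ : 0 < η / (2 * (L + 1)) := by positivity
  -- Beyond radius `L / η` the Lipschitz bound from 0 is already below `η x²`, so a net of a compact
  -- interval suffices. It is independent of `D`, so random `D` are allowed; `L + 1` covers `L = 0`.
  obtain ⟨t, -, ht, hcov⟩ := (isCompact_Icc (a := -(L / η)) (b := L / η)).finite_cover_balls hρ
  refine ⟨insert 0 ht.toFinset, fun D hD hT x => ?_⟩
  have tri : ∀ z, |D x| ≤ |D z| + L * |x - z| := fun z => by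
    have := hD x z
    have := abs_sub_abs_le_abs_sub (D x) (D z)
    linarith
  rcases le_total |x| (L / η) with hx | hx
  · obtain ⟨z, hz, hxz⟩ := Set.mem_iUnion₂.1 (hcov (abs_le.1 hx))
    have h1 := tri z
    have h2 := hT z (Finset.mem_insert_of_mem (ht.mem_toFinset.2 hz))
    rw [Metric.mem_ball, Real.dist_eq] at hxz
    have h3 : L * |x - z| ≤ η / 2 := by
      have e : (L + 1) * (η / (2 * (L + 1))) = η / 2 := by field_simp
      nlinarith [abs_nonneg (x - z)]
    nlinarith [sq_nonneg x]
  · have h1 := tri 0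
    have h2 := hT 0 (Finset.mem_insert_self _ _)
    rw [div_le_iff₀ hη] at hx
    rw [sub_zero] at h1
    rw [← sq_abs x]
    nlinarith [abs_nonneg x]

end Net

/-! ### The mixing density for typical fields, and the choice of index. -/

section Deterministic

lemma logDensity_eq_sum_range (β : ℝ) (h : ℕ → ℝ) (N : ℕ) (y : ℝ) :
    logDensity β h N y
      = -(N * (y ^ 2 / 2)) + ∑ i ∈ Finset.range N, logCosh (√β * y + β * h i) := by
  rw [logDensity, Finset.sum_range]

/-- Convexity of `log cosh`: only the Gaussian term can bend the density downwards, with curvature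
`-N`. -/
lemma le_logDensity_add (β : ℝ) (h : ℕ → ℝ) (N : ℕ) (a u : ℝ) :
    logDensity β h N a + u * ∑ i ∈ Finset.range N, (√β * Real.tanh (√β * a + β * h i) - a)
      - N * (u ^ 2 / 2) ≤ logDensity β h N (a + u) := by
  have h1 : ∑ i ∈ Finset.range N, (logCosh (√β * a + β * h i)
        + u * (√β * Real.tanh (√β * a + β * h i) - a))
      ≤ ∑ i ∈ Finset.range N, (logCosh (√β * (a + u) + β * h i) - u * a) := by
    refine Finset.sum_le_sum fun i _ => ?_
    have := logCosh_tangent_le (√β * a + β * h i) (√β * u)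
    rw [show √β * a + β * h i + √β * u = √β * (a + u) + β * h i by ring] at this
    linarith
  rw [Finset.sum_add_distrib, ← Finset.mul_sum, Finset.sum_sub_distrib (fun i => logCosh _),
    Finset.sum_const, Finset.card_range, nsmul_eq_mul] at h1
  rw [logDensity_eq_sum_range, logDensity_eq_sum_range]
  linarith

lemma logDensity_add_le {β : ℝ} (hβ : 0 ≤ β) (h : ℕ → ℝ) (N : ℕ) (a u : ℝ) :
    logDensity β h N (a + u) ≤ logDensity β h N a
      + u * ∑ i ∈ Finset.range N, (√β * Real.tanh (√β * a + β * h i) - a)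
      + u ^ 2 / 2 * (∑ i ∈ Finset.range N, β * (1 - Real.tanh (√β * a + β * h i) ^ 2) - N)
      + N * (√β ^ 3 * |u| ^ 3) := by
  have h1 : ∑ i ∈ Finset.range N, (logCosh (√β * (a + u) + β * h i) - u * a)
      ≤ ∑ i ∈ Finset.range N, (logCosh (√β * a + β * h i)
        + u * (√β * Real.tanh (√β * a + β * h i) - a)
        + u ^ 2 / 2 * (β * (1 - Real.tanh (√β * a + β * h i) ^ 2)) + √β ^ 3 * |u| ^ 3) := by
    refine Finset.sum_le_sum fun i _ => ?_
    have := logCosh_le_taylor (√β * a + β * h i) (√β * u)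
    rw [show √β * a + β * h i + √β * u = √β * (a + u) + β * h i by ring, abs_mul,
      abs_of_nonneg (Real.sqrt_nonneg β), mul_pow, mul_pow, Real.sq_sqrt hβ] at this
    linarith
  rw [Finset.sum_add_distrib, Finset.sum_add_distrib, Finset.sum_add_distrib, ← Finset.mul_sum,
    ← Finset.mul_sum, Finset.sum_sub_distrib (fun i => logCosh _), Finset.sum_const,
    Finset.sum_const, Finset.card_range, nsmul_eq_mul, nsmul_eq_mul] at h1
  rw [logDensity_eq_sum_range, logDensity_eq_sum_range]
  linarith

/-- Closeness of the marginal to a product measure, for fields that behave typically. -/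
theorem abs_marginal_sub_productMass_le_of_typical {β : ℝ} (hβ : 0 ≤ β) (h : ℕ → ℝ) {N k : ℕ}
    (hN : 0 < N) (hkN : k ≤ N) {G : ℝ → ℝ} {ι : Type*} [Fintype ι] (y : ι → ℝ) (J : ι)
    {K c η η' r M : ℝ} (hK : 0 ≤ K) (hc : 0 < c) (hη : 0 < η) (hr : 0 ≤ r)
    (hrc : √β ^ 3 * r ≤ c / 2) (hη' : η' ≤ η) (hηy : ∀ j, η' * (1 + y j ^ 2) ≤ η)
    (slope : ∀ j, |∑ i ∈ Finset.range N, (√β * Real.tanh (√β * y j + β * h i) - y j)| ≤ K * √N)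
    (curv : ∀ j, (∑ i ∈ Finset.range N, β * (1 - Real.tanh (√β * y j + β * h i) ^ 2)) / N
      ≤ 1 - 3 * c)
    (unif : ∀ x, |logDensity β h N x / N - G x| ≤ η' * (1 + x ^ 2))
    (far : ∀ x, (∀ i, r ≤ |x - y i|) → G x ≤ G (y J) - 3 * η * (1 + x ^ 2))
    (gap : ∀ i, i ≠ J → logDensity β h N (y i) ≤ logDensity β h N (y J) - M) (τ : Config k) :
    |marginal β h N k τ - productMass β (y J) h k τ|
      ≤ 2 * k * √β * r + laplaceBound (Fintype.card ι) K c η M N := by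
  have hN' : (0 : ℝ) < N := Nat.cast_pos.2 hN
  have hslope : ∀ j u, |u * ∑ i ∈ Finset.range N, (√β * Real.tanh (√β * y j + β * h i) - y j)|
      ≤ K * √N * |u| := fun j u => by
    rw [abs_mul, mul_comm]
    exact mul_le_mul_of_nonneg_right (slope j) (abs_nonneg u)
  refine abs_marginal_sub_productMass_le hβ h hN hkN τ (y J) hr
    (setIntegral_exp_le_laplaceBound_mul (integrable_exp_logDensity hβ h hN) y J hN' hK hc hη
      ?_ ?_ ?_ gap)
  · intro u
    have h1 := le_logDensity_add β h N (y J) u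
    have h2 := (abs_le.1 (hslope J u)).1
    linarith
  · intro i u hu
    have h1 := logDensity_add_le hβ h N (y i) u
    have h2 := (abs_le.1 (hslope i u)).2
    have h3 := curv i
    rw [div_le_iff₀ hN'] at h3
    -- The curvature gives `-(3 / 2) c N u²`; the cubic remainder inside radius `r` spends `c N u² /
    -- 2`, leaving `-c N u²`.
    have h4 : u ^ 2 / 2 * (∑ i' ∈ Finset.range N, β * (1 - Real.tanh (√β * y i + β * h i') ^ 2) - N)
        ≤ u ^ 2 / 2 * (-(3 * c * N)) :=
      mul_le_mul_of_nonneg_left (by linarith) (by positivity)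
    have h5 : √β ^ 3 * |u| ^ 3 ≤ c / 2 * u ^ 2 := by
      have e : √β ^ 3 * |u| ≤ c / 2 :=
        (mul_le_mul_of_nonneg_left hu.le (by positivity)).trans hrc
      have := mul_le_mul_of_nonneg_right e (sq_nonneg |u|)
      rw [sq_abs] at this
      calc √β ^ 3 * |u| ^ 3 = √β ^ 3 * |u| * |u| ^ 2 := by ring
        _ = √β ^ 3 * |u| * u ^ 2 := by rw [sq_abs]
        _ ≤ _ := this
    have h6 := mul_le_mul_of_nonneg_left h5 hN'.le
    linarith
  · intro x hx
    have h1 := (abs_le.1 (unif x)).2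
    have h2 := (abs_le.1 (unif (y J))).1
    have h3 := far x hx
    have h4 := hηy J
    have h5 : η' * (1 + x ^ 2) ≤ η * (1 + x ^ 2) :=
      mul_le_mul_of_nonneg_right hη' (by positivity)
    have h6 : 0 ≤ η * x ^ 2 := by positivity
    -- Of the margin `3 η`, the approximation errors at `x` and at `y J` each consume at most one
    -- share.
    have h7 : logDensity β h N x / N ≤ logDensity β h N (y J) / N - η * (1 + x ^ 2) := by linarith
    rw [div_le_iff₀ hN', sub_mul, div_mul_cancel₀ _ hN'.ne'] at h7
    linarith

/-- A fixed `M` makes the contribution of the other peaks small for all `N`; the far region then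
vanishes as `N` grows. -/
lemma eventually_laplaceBound_lt (n : ℕ) (K c : ℝ) {η ε : ℝ} (hη : 0 < η) (hε : 0 < ε) :
    ∃ M, ∀ᶠ N : ℕ in atTop, laplaceBound n K c η M N < ε := by
  have h1 : Tendsto (fun M : ℝ => Real.exp (K + 1 / 2) / 2 *
      (n * Real.exp (-M + K ^ 2 / (2 * c)) * √(Real.pi / (c / 2)))) atTop (𝓝 0) := by
    have : Tendsto (fun M : ℝ => Real.exp (-M + K ^ 2 / (2 * c))) atTop (𝓝 0) :=
      Real.tendsto_exp_atBot.comp (tendsto_atBot_add_const_right _ _ tendsto_neg_atTop_atBot)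
    simpa using ((this.const_mul (n : ℝ)).mul_const (√(Real.pi / (c / 2)))).const_mul
      (Real.exp (K + 1 / 2) / 2)
  obtain ⟨M, hM⟩ := (h1.eventually_lt_const hε).exists
  refine ⟨M, ?_⟩
  have h2 : Tendsto (fun N : ℕ => laplaceBound n K c η M N) atTop (𝓝 (Real.exp (K + 1 / 2) / 2 *
      (n * Real.exp (-M + K ^ 2 / (2 * c)) * √(Real.pi / (c / 2)) + 0 * √(Real.pi / η)))) := by
    have : Tendsto (fun N : ℕ => Real.exp (-(N * η))) atTop (𝓝 0) :=
      Real.tendsto_exp_atBot.comp (tendsto_neg_atTop_atBot.comp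
        (tendsto_natCast_atTop_atTop.atTop_mul_const hη))
    exact ((this.mul_const _).const_add _).const_mul _
  rw [zero_mul, add_zero] at h2
  exact h2.eventually_lt_const hM

/-- The maximising index of finitely many measurable functions can be chosen measurably. -/
lemma exists_measurable_argmax {α : Type*} [MeasurableSpace α] {s : ℕ} (f : Fin (s + 1) → α → ℝ)
    (hf : ∀ j, Measurable (f j)) :
    ∃ J : α → Fin (s + 1), Measurable J ∧ ∀ x i, f i x ≤ f (J x) x := by
  classical
  have hex : ∀ x, ∃ n : ℕ, ∃ hn : n < s + 1, ∀ i, f i x ≤ f ⟨n, hn⟩ x := fun x => by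
    obtain ⟨j, hj⟩ := Finite.exists_max fun i => f i x
    exact ⟨j, j.2, hj⟩
  -- Ties are broken by the least maximising index.
  have hm : Measurable fun x => Nat.find (hex x) := by
    refine measurable_find hex fun n => ?_
    by_cases hn : n < s + 1
    · simp only [hn, exists_true_left, Set.ofPred_forall]
      exact MeasurableSet.iInter fun i => measurableSet_le (hf i) (hf _)
    · simp [hn]
  refine ⟨fun x => Fin.ofNat (s + 1) (Nat.find (hex x)),
    (Measurable.of_discrete (f := fun n : ℕ => Fin.ofNat (s + 1) n)).comp hm, fun x i => ?_⟩
  obtain ⟨hn, H⟩ := Nat.find_spec (hex x)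
  have e : Fin.ofNat (s + 1) (Nat.find (hex x)) = ⟨Nat.find (hex x), hn⟩ := by
    ext
    exact Nat.mod_eq_of_lt hn
  change f i x ≤ f (Fin.ofNat (s + 1) (Nat.find (hex x))) x
  rw [e]
  exact H i

end Deterministic

/-! ### Typical fields have probability close to one. -/

section Probability

variable {Ω : Type*} [MeasurableSpace Ω] {P : Measure Ω}

lemma tendsto_measure_iUnion_zero {ι : Type*} [Fintype ι] {A : ι → ℕ → Set Ω}
    (hA : ∀ i, Tendsto (fun n => P (A i n)) atTop (𝓝 0)) :
    Tendsto (fun n => P (⋃ i, A i n)) atTop (𝓝 0) := by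
  have h1 : Tendsto (fun n => ∑ i, P (A i n)) atTop (𝓝 0) := by
    simpa using tendsto_finsetSum Finset.univ fun i _ => hA i
  refine tendsto_of_tendsto_of_tendsto_of_le_of_le tendsto_const_nhds h1 (fun _ => zero_le)
    fun n => ?_
  exact measure_iUnion_fintype_le P _

variable [IsProbabilityMeasure P]

lemma abs_integral_logCosh_sub_le (β : ℝ) {X : Ω → ℝ} (hX : Integrable X P) (x z : ℝ) :
    |∫ ω, logCosh (√β * x + β * X ω) ∂P - ∫ ω, logCosh (√β * z + β * X ω) ∂P| ≤ √β * |x - z| := by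
  rw [← integral_sub (integrable_logCosh β hX x) (integrable_logCosh β hX z)]
  have := norm_integral_le_of_norm_le_const (μ := P) (C := √β * |x - z|)
    (f := fun ω => logCosh (√β * x + β * X ω) - logCosh (√β * z + β * X ω))
    (Eventually.of_forall fun ω => by
      refine (abs_logCosh_sub_le _ _).trans (le_of_eq ?_)
      rw [show √β * x + β * X ω - (√β * z + β * X ω) = √β * (x - z) by ring, abs_mul,
        abs_of_nonneg (Real.sqrt_nonneg _)])
  simpa using this

/-- The quadratic terms cancel, so the error is globally Lipschitz, as `exists_finset_abs_le`
requires. -/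
lemma abs_logDensity_div_sub_freeEnergy_sub_le (β : ℝ) {X : Ω → ℝ} (hX : Integrable X P)
    (h : ℕ → ℝ) {N : ℕ} (hN : 0 < N) (x z : ℝ) :
    |(logDensity β h N x / N - freeEnergy β P X x) - (logDensity β h N z / N - freeEnergy β P X z)|
      ≤ 2 * √β * |x - z| := by
  have hN' : (0 : ℝ) < N := Nat.cast_pos.2 hN
  have h1 := abs_integral_logCosh_sub_le β hX x z
  have h2 : |(∑ i ∈ Finset.range N, logCosh (√β * x + β * h i)
      - ∑ i ∈ Finset.range N, logCosh (√β * z + β * h i)) / N| ≤ √β * |x - z| := by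
    rw [abs_div, abs_of_pos hN', div_le_iff₀ hN', ← Finset.sum_sub_distrib]
    refine (Finset.abs_sum_le_sum_abs _ _).trans ?_
    refine (Finset.sum_le_sum (g := fun _ => √β * |x - z|) fun i _ => ?_).trans (le_of_eq ?_)
    · refine (abs_logCosh_sub_le _ _).trans (le_of_eq ?_)
      rw [show √β * x + β * h i - (√β * z + β * h i) = √β * (x - z) by ring, abs_mul,
        abs_of_nonneg (Real.sqrt_nonneg _)]
    · simp [mul_comm]
  have e : (logDensity β h N x / N - freeEnergy β P X x)
      - (logDensity β h N z / N - freeEnergy β P X z)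
      = (∑ i ∈ Finset.range N, logCosh (√β * x + β * h i)
      - ∑ i ∈ Finset.range N, logCosh (√β * z + β * h i)) / N
      - (∫ ω, logCosh (√β * x + β * X ω) ∂P - ∫ ω, logCosh (√β * z + β * X ω) ∂P) := by
    have e1 : ∀ x, freeEnergy β P X x = -(x ^ 2 / 2) + ∫ ω, logCosh (√β * x + β * X ω) ∂P :=
      fun _ => rfl
    rw [e1, e1, logDensity_eq_sum_range, logDensity_eq_sum_range]
    field_simp
    ring
  rw [e]
  refine (abs_sub _ _).trans ?_
  linarith

variable {β : ℝ} {h : ℕ → Ω → ℝ}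

/-- In probability, the marginal is close to the product measure belonging to the highest peak of
the mixing density. -/
theorem tendsto_measure_exists_le_abs_marginal_sub (hβ : 0 < β)
    (h_meas : ∀ i, Measurable (h i)) (h_indep : iIndepFun h P)
    (h_ident : ∀ i, IdentDistrib (h i) (h 0) P P) (h_sq : MemLp (h 0) 2 P)
    (h_ne : ∫ ω, (h 0 ω) ^ 2 ∂P ≠ 0) {ι : Type*} [Fintype ι] [Nonempty ι] {y : ι → ℝ}
    (y_inj : Function.Injective y)
    (y_max : ∀ x : ℝ, IsGlobalMax (freeEnergy β P (h 0)) x ↔ ∃ j, y j = x)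
    (y_nondeg : ∀ j, IsNondegenerate (freeEnergy β P (h 0)) (y j)) (k : ℕ)
    (J : ℕ → Ω → ι)
    (hJ : ∀ N ω i, logDensity β (fun i => h i ω) N (y i)
      ≤ logDensity β (fun i => h i ω) N (y (J N ω))) {ε : ℝ} (hε : 0 < ε) :
    Tendsto (fun N => P {ω | ∃ τ : Config k, ε ≤ |marginal β (fun i => h i ω) N k τ
      - productMass β (y (J N ω)) (fun i => h i ω) k τ|}) atTop (𝓝 0) := by
  classical
  have hint : Integrable (h 0) P := h_sq.integrable one_le_two
  set G := freeEnergy β P (h 0)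
  have hβ0 := hβ.le
  have mt := continuous_tanh.measurable
  have ml := continuous_logCosh.measurable
  -- the curvature at the maxima
  have hcurv : ∀ j, ∫ ω, β * (1 - Real.tanh (√β * y j + β * h 0 ω) ^ 2) ∂P < 1 := by
    intro j
    have := (y_nondeg j).2
    rw [(hasDerivAt_deriv_freeEnergy hβ0 hint (y j)).deriv] at this
    linarith
  -- Of the four shares of `c`, one is given to the law of large numbers and three remain for the
  -- empirical curvature.
  obtain ⟨c, hc, hcj⟩ : ∃ c > 0, ∀ j,
      ∫ ω, β * (1 - Real.tanh (√β * y j + β * h 0 ω) ^ 2) ∂P ≤ 1 - 4 * c := by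
    obtain ⟨j₀, hj₀⟩ := Finite.exists_max fun j =>
      ∫ ω, β * (1 - Real.tanh (√β * y j + β * h 0 ω) ^ 2) ∂P
    refine ⟨(1 - ∫ ω, β * (1 - Real.tanh (√β * y j₀ + β * h 0 ω) ^ 2) ∂P) / 4, ?_, fun j => ?_⟩
    · have := hcurv j₀
      linarith
    · have := hj₀ j
      linarith
  -- the radius of the neighbourhoods of the maxima
  obtain ⟨r, hr, hrc, hrε⟩ : ∃ r > 0, √β ^ 3 * r ≤ c / 2 ∧ 2 * k * √β * r ≤ ε / 4 := by
    have h1 : Tendsto (fun r : ℝ => √β ^ 3 * r) (𝓝[>] 0) (𝓝 0) := by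
      have : Continuous fun r : ℝ => √β ^ 3 * r := by fun_prop
      simpa using (this.tendsto 0).mono_left nhdsWithin_le_nhds
    have h2 : Tendsto (fun r : ℝ => 2 * k * √β * r) (𝓝[>] 0) (𝓝 0) := by
      have : Continuous fun r : ℝ => 2 * k * √β * r := by fun_prop
      simpa using (this.tendsto 0).mono_left nhdsWithin_le_nhds
    obtain ⟨r, ⟨hr1, hr2⟩, hr3⟩ := (((h1.eventually_lt_const (half_pos hc)).and
      (h2.eventually_lt_const (show 0 < ε / 4 by linarith))).and self_mem_nhdsWithin).exists
    exact ⟨r, hr3, hr1.le, hr2.le⟩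
  -- the margin outside these neighbourhoods
  obtain ⟨η₀, hη₀, hfar⟩ := exists_freeEnergy_le_sub hβ0 hint y_max hr
  set η := η₀ / 3 with hη_def
  have hη : 0 < η := by positivity
  obtain ⟨η', hη'pos, hη'η, hη'y⟩ : ∃ η' > 0, η' ≤ η ∧ ∀ j, η' * (1 + y j ^ 2) ≤ η := by
    have hY : 0 ≤ ∑ j, y j ^ 2 := Finset.sum_nonneg fun j _ => sq_nonneg _
    have hpos : 0 < η / (1 + ∑ j, y j ^ 2) := by positivity
    have hall : ∀ t, t ≤ ∑ j, y j ^ 2 → η / (1 + ∑ j, y j ^ 2) * (1 + t) ≤ η := fun t ht => by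
      rw [div_mul_eq_mul_div, div_le_iff₀ (by positivity)]
      exact mul_le_mul_of_nonneg_left (by linarith) hη.le
    refine ⟨_, hpos, by simpa using hall 0 hY, fun j => hall _ ?_⟩
    exact Finset.single_le_sum (f := fun j => y j ^ 2) (fun j _ => sq_nonneg _) (Finset.mem_univ j)
  obtain ⟨T, hT⟩ := exists_finset_abs_le (L := 2 * √β) (by positivity) hη'pos
  rw [ENNReal.tendsto_nhds_zero]
  intro δ hδ
  have hδ2 : 0 < δ / 2 := ENNReal.half_pos hδ.ne'
  -- fluctuations of the slope at the maxima
  set gS : ι → ℝ → ℝ := fun j t => √β * Real.tanh (√β * y j + β * t) - y j with hgS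
  have gS_meas : ∀ j, Measurable (gS j) := fun j => by rw [hgS]; fun_prop
  have gS_memLp : ∀ j, MemLp (fun ω => gS j (h 0 ω)) 2 P := fun j => by
    refine MemLp.of_bound ((gS_meas j).comp (h_meas 0)).aestronglyMeasurable (√β + |y j|)
      (Eventually.of_forall fun ω => ?_)
    rw [Real.norm_eq_abs, hgS]
    refine (abs_sub _ _).trans ?_
    rw [abs_mul, abs_of_nonneg (Real.sqrt_nonneg β)]
    have := mul_le_of_le_one_right (Real.sqrt_nonneg β)
      (Real.abs_tanh_lt_one (√β * y j + β * h 0 ω)).le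
    linarith
  have gS_mean : ∀ j, P[fun ω => gS j (h 0 ω)] = 0 := fun j => by
    have h1 := (y_nondeg j).1
    rw [(hasDerivAt_freeEnergy hint (y j)).deriv] at h1
    have h2 : Integrable (fun ω => √β * Real.tanh (√β * y j + β * h 0 ω)) P :=
      (Integrable.of_bound (aestronglyMeasurable_tanh β hint.aestronglyMeasurable (y j)) 1
        (Eventually.of_forall fun ω => (Real.abs_tanh_lt_one _).le)).const_mul _
    rw [hgS]
    simp only
    rw [integral_sub h2 (integrable_const _)]
    simp only [integral_const, probReal_univ, one_smul]
    linarith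
  have gS_prob : ∀ (j : ι) (K : ℝ), 0 < K → ∀ N : ℕ, 0 < N →
      P {ω | K * √N < |∑ i ∈ Finset.range N, gS j (h i ω)|}
        ≤ ENNReal.ofReal (Var[fun ω => gS j (h 0 ω); P] / K ^ 2) := fun j K hK N hN =>
    measure_abs_sum_gt_le (X := fun i ω => gS j (h i ω)) (gS_memLp j)
      (h_indep.comp (fun _ => gS j) fun _ => gS_meas j)
      (fun i => (h_ident i).comp (gS_meas j)) (gS_mean j) hK hN
  -- The slope event does not vanish as `N → ∞`; `K` is chosen from `δ` so that it has probability
  -- at most `δ / 2` for every `N > 0`. The gap `M` can therefore be fixed only after `K`.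
  obtain ⟨K, hK, hKδ⟩ : ∃ K : ℝ, 0 < K ∧
      ∑ j, ENNReal.ofReal (Var[fun ω => gS j (h 0 ω); P] / K ^ 2) ≤ δ / 2 := by
    have h1 : Tendsto (fun K : ℝ => ∑ j, ENNReal.ofReal (Var[fun ω => gS j (h 0 ω); P] / K ^ 2))
        atTop (𝓝 0) := by
      have : ∀ j, Tendsto (fun K : ℝ => ENNReal.ofReal (Var[fun ω => gS j (h 0 ω); P] / K ^ 2))
          atTop (𝓝 0) := fun j => by
        rw [← ENNReal.ofReal_zero]
        exact (ENNReal.continuous_ofReal.tendsto 0).comp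
          (tendsto_const_nhds.div_atTop (tendsto_pow_atTop two_ne_zero))
      simpa using tendsto_finsetSum Finset.univ fun j _ => this j
    obtain ⟨K, hK1, hK2⟩ := ((ENNReal.tendsto_nhds_zero.1 h1 _ hδ2).and
      (eventually_gt_atTop (0 : ℝ))).exists
    exact ⟨K, hK2, hK1⟩
  obtain ⟨M, hM⟩ := eventually_laplaceBound_lt (Fintype.card ι) K c hη (half_pos hε)
  -- the gaps between the peaks
  set gB : ι × ι → ℝ → ℝ := fun p t => logCosh (√β * y p.1 + β * t) - logCosh (√β * y p.2 + β * t)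
    - (y p.1 ^ 2 - y p.2 ^ 2) / 2 with hgB
  have gB_meas : ∀ p, Measurable (gB p) := fun p => by rw [hgB]; fun_prop
  have gB_sum : ∀ p N ω, ∑ i ∈ Finset.range N, gB p (h i ω)
      = logDensity β (fun i => h i ω) N (y p.1) - logDensity β (fun i => h i ω) N (y p.2) := by
    intro p N ω
    rw [hgB, logDensity_eq_sum_range, logDensity_eq_sum_range]
    simp only [Finset.sum_sub_distrib, Finset.sum_const, Finset.card_range, nsmul_eq_mul]
    ring
  have gB_prob : ∀ p : {p : ι × ι // p.1 ≠ p.2}, Tendsto (fun N : ℕ =>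
      P {ω | |∑ i ∈ Finset.range N, gB p (h i ω)| ≤ M}) atTop (𝓝 0) := by
    rintro ⟨p, hp⟩
    have hL : MemLp (fun ω => gB p (h 0 ω)) 2 P := by
      refine MemLp.of_bound ((gB_meas p).comp (h_meas 0)).aestronglyMeasurable
        (|√β * y p.1 - √β * y p.2| + |(y p.1 ^ 2 - y p.2 ^ 2) / 2|)
        (Eventually.of_forall fun ω => ?_)
      rw [Real.norm_eq_abs, hgB]
      refine (abs_sub _ _).trans (add_le_add_left ?_ _)
      refine (abs_logCosh_sub_le _ _).trans (le_of_eq ?_)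
      congr 1
      ring
    have hmean : P[fun ω => gB p (h 0 ω)] = 0 := by
      have h1 : G (y p.1) = G (y p.2) :=
        le_antisymm ((y_max _).2 ⟨p.2, rfl⟩ _) ((y_max _).2 ⟨p.1, rfl⟩ _)
      have e1 : ∀ x, G x = -(x ^ 2 / 2) + ∫ ω, logCosh (√β * x + β * h 0 ω) ∂P := fun _ => rfl
      rw [e1, e1] at h1
      rw [hgB]
      simp only
      rw [integral_sub (f := fun ω => logCosh (√β * y p.1 + β * h 0 ω)
        - logCosh (√β * y p.2 + β * h 0 ω)) ((integrable_logCosh β hint _).sub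
        (integrable_logCosh β hint _)) (integrable_const _), integral_sub (integrable_logCosh β hint _)
        (integrable_logCosh β hint _)]
      simp only [integral_const, probReal_univ, one_smul]
      linarith
    refine tendsto_measure_abs_sum_le (X := fun i ω => gB p (h i ω)) hL
      (h_indep.comp (fun _ => gB p) fun _ => gB_meas p) (fun i => (h_ident i).comp (gB_meas p))
      hmean (fun hvar => ?_) M
    refine not_ae_logCosh_sub_eq hβ h_ne (fun e => hp (y_inj e)) ((y_max _).2 ⟨p.1, rfl⟩)
      ((y_max _).2 ⟨p.2, rfl⟩) ((y p.1 ^ 2 - y p.2 ^ 2) / 2) ?_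
    filter_upwards [ae_eq_integral_of_variance_eq_zero hL hvar] with ω hω
    rw [hmean] at hω
    simp only [hgB] at hω
    linarith
  -- laws of large numbers
  set gC : ι → ℝ → ℝ := fun j t => β * (1 - Real.tanh (√β * y j + β * t) ^ 2) with hgC
  have gC_meas : ∀ j, Measurable (gC j) := fun j => by rw [hgC]; fun_prop
  have gC_prob : ∀ j, Tendsto (fun N : ℕ =>
      P {ω | c < |(∑ i ∈ Finset.range N, gC j (h i ω)) / N - P[fun ω => gC j (h 0 ω)]|})
      atTop (𝓝 0) := fun j => by
    refine tendsto_measure_average (X := fun i ω => gC j (h i ω))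
      (fun i => (gC_meas j).comp (h_meas i)) ?_
      (h_indep.comp (fun _ => gC j) fun _ => gC_meas j) (fun i => (h_ident i).comp (gC_meas j)) hc
    refine Integrable.of_bound ((gC_meas j).comp (h_meas 0)).aestronglyMeasurable β
      (Eventually.of_forall fun ω => ?_)
    have h1 := Real.tanh_sq_lt_one (√β * y j + β * h 0 ω)
    have h2 := sq_nonneg (Real.tanh (√β * y j + β * h 0 ω))
    rw [Real.norm_eq_abs, hgC, abs_mul, abs_of_pos hβ, abs_of_pos (sub_pos.2 h1)]
    exact mul_le_of_le_one_right hβ0 (by linarith)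
  set gD : ℝ → ℝ → ℝ := fun z t => logCosh (√β * z + β * t) with hgD
  have gD_meas : ∀ z, Measurable (gD z) := fun z => by rw [hgD]; fun_prop
  have gD_prob : ∀ z : T, Tendsto (fun N : ℕ => P {ω | η' / 2 <
      |(∑ i ∈ Finset.range N, gD z (h i ω)) / N - P[fun ω => gD z (h 0 ω)]|}) atTop (𝓝 0) :=
    fun z => tendsto_measure_average (X := fun i ω => gD z (h i ω))
      (fun i => (gD_meas z).comp (h_meas i)) (integrable_logCosh β hint z)
      (h_indep.comp (fun _ => gD z) fun _ => gD_meas z) (fun i => (h_ident i).comp (gD_meas z))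
      (half_pos hη'pos)
  have hBCD := ((tendsto_measure_iUnion_zero gB_prob).add
    (tendsto_measure_iUnion_zero gC_prob)).add (tendsto_measure_iUnion_zero gD_prob)
  rw [add_zero, add_zero] at hBCD
  filter_upwards [ENNReal.tendsto_nhds_zero.1 hBCD _ hδ2, hM, eventually_gt_atTop 0,
    eventually_ge_atTop k] with N hNδ hNM hN hkN
  have hN' : (0 : ℝ) < N := Nat.cast_pos.2 hN
  set A := ⋃ j, {ω | K * √N < |∑ i ∈ Finset.range N, gS j (h i ω)|} with hA
  have hAδ : P A ≤ δ / 2 := (measure_iUnion_fintype_le P _).trans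
    ((Finset.sum_le_sum fun j _ => gS_prob j K hK N hN).trans hKδ)
  set B := ⋃ p : {p : ι × ι // p.1 ≠ p.2}, {ω | |∑ i ∈ Finset.range N, gB p (h i ω)| ≤ M} with hB
  set C := ⋃ j, {ω | c < |(∑ i ∈ Finset.range N, gC j (h i ω)) / N
    - P[fun ω => gC j (h 0 ω)]|} with hC
  set D := ⋃ z : T, {ω | η' / 2 < |(∑ i ∈ Finset.range N, gD z (h i ω)) / N
    - P[fun ω => gD z (h 0 ω)]|} with hD
  have hsub : {ω | ∃ τ : Config k, ε ≤ |marginal β (fun i => h i ω) N k τ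
      - productMass β (y (J N ω)) (fun i => h i ω) k τ|} ⊆ A ∪ (B ∪ C ∪ D) := by
    rintro ω ⟨τ, hτ⟩
    by_contra hω
    simp only [Set.mem_union, not_or] at hω
    obtain ⟨hωA, ⟨hωB, hωC⟩, hωD⟩ := hω
    rw [hA, Set.mem_iUnion, not_exists] at hωA
    rw [hB, Set.mem_iUnion, not_exists] at hωB
    rw [hC, Set.mem_iUnion, not_exists] at hωC
    rw [hD, Set.mem_iUnion, not_exists] at hωD
    simp only [Set.mem_ofPred_eq, not_lt, not_le] at hωA hωB hωC hωD
    have key := abs_marginal_sub_productMass_le_of_typical hβ0 (fun i => h i ω) hN hkN (G := G) y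
      (J N ω) (M := M) hK.le hc hη hr.le hrc hη'η hη'y (fun j => hωA j) (fun j => ?_) ?_
      (fun x hx => ?_) (fun i hi => ?_) τ
    · linarith
    · have h1 := (abs_le.1 (hωC j)).2
      have h2 := hcj j
      change (∑ i ∈ Finset.range N, gC j (h i ω)) / N ≤ _
      change ∫ ω, gC j (h 0 ω) ∂P ≤ _ at h2
      linarith
    · refine hT (fun x => logDensity β (fun i => h i ω) N x / N - G x)
        (abs_logDensity_div_sub_freeEnergy_sub_le β hint (fun i => h i ω) hN) fun z hz => ?_
      have h1 := hωD ⟨z, hz⟩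
      convert! h1 using 2
      have e1 : G z = -(z ^ 2 / 2) + ∫ ω, gD z (h 0 ω) ∂P := rfl
      change _ = (∑ i ∈ Finset.range N, logCosh (√β * z + β * h i ω)) / N - ∫ ω, gD z (h 0 ω) ∂P
      rw [e1, logDensity_eq_sum_range]
      field_simp
      ring
    · have := hfar (J N ω) x hx
      rw [hη_def]
      linarith
    · have h1 := hωB ⟨(i, J N ω), hi⟩
      rw [gB_sum] at h1
      have h2 := hJ N ω i
      simp only at h1
      -- `J` maximises the peak values, which fixes the sign of the difference and turns its size
      -- into a gap.
      rw [abs_of_nonpos (by linarith)] at h1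
      linarith
  calc P _ ≤ P (A ∪ (B ∪ C ∪ D)) := measure_mono hsub
    _ ≤ P A + (P B + P C + P D) := (measure_union_le _ _).trans (add_le_add_right
        ((measure_union_le _ _).trans (add_le_add_left (measure_union_le _ _) _)) _)
    _ ≤ δ / 2 + δ / 2 := add_le_add hAδ hNδ
    _ = δ := ENNReal.add_halves δ

end Probability

/-! ### From mass functions to relative entropy in probability. -/

section RelativeEntropyLimit

variable {Ω : Type*} [MeasurableSpace Ω] {P : Measure Ω} [IsProbabilityMeasure P]

lemma tendsto_measure_ge_atTop {S : Ω → ℝ} (hS : Integrable S P) (hS0 : ∀ ω, 0 ≤ S ω) :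
    Tendsto (fun A : ℝ => P {ω | A ≤ S ω}) atTop (𝓝 0) := by
  have h1 : Tendsto (fun A : ℝ => ENNReal.ofReal ((∫ ω, S ω ∂P) / A)) atTop (𝓝 0) := by
    rw [← ENNReal.ofReal_zero]
    exact (ENNReal.continuous_ofReal.tendsto 0).comp (tendsto_const_nhds.div_atTop tendsto_id)
  refine tendsto_of_tendsto_of_tendsto_of_le_of_le' tendsto_const_nhds h1
    (Eventually.of_forall fun _ => zero_le) ?_
  filter_upwards [eventually_gt_atTop 0] with A hA
  have h2 := mul_meas_ge_le_integral_of_nonneg (Eventually.of_forall hS0) hS A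
  rw [← ofReal_measureReal]
  refine ENNReal.ofReal_le_ofReal ?_
  rw [le_div_iff₀ hA]
  linarith

lemma sum_sq_div_productMass_lt {β : ℝ} (hβ : 0 ≤ β) {k : ℕ} {h : ℕ → ℝ} {p : Config k → ℝ}
    {a Y A e e' : ℝ} (ha : |a| ≤ Y) (hA : ∑ i : Fin k, |h i| ≤ A)
    (he : Fintype.card (Config k) * e' ^ 2 / Real.exp (-(k * (2 * √β * Y + Real.log 2) + 2 * β * A))
      < e)
    (hp : ∀ τ, |p τ - productMass β a h k τ| ≤ e') :
    ∑ τ, (p τ - productMass β a h k τ) ^ 2 / productMass β a h k τ < e := by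
  refine lt_of_le_of_lt ?_ he
  set c₀ := Real.exp (-(k * (2 * √β * Y + Real.log 2) + 2 * β * A)) with hc₀
  have hlow : ∀ τ, c₀ ≤ productMass β a h k τ := fun τ => by
    refine le_trans ?_ (exp_neg_le_productMass β a h k τ)
    rw [hc₀, Real.exp_le_exp, neg_le_neg_iff]
    have e1 : ∑ i : Fin k, (2 * (√β * |a| + |β| * |h i|) + Real.log 2)
        = k * (2 * √β * |a| + Real.log 2) + 2 * β * ∑ i : Fin k, |h i| := by
      rw [Finset.sum_add_distrib, ← Finset.mul_sum, Finset.sum_add_distrib,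
        ← Finset.mul_sum (f := fun i : Fin k => |h i|), abs_of_nonneg hβ]
      simp
      ring
    rw [e1]
    gcongr
  have hterm : ∀ τ ∈ (Finset.univ : Finset (Config k)),
      (p τ - productMass β a h k τ) ^ 2 / productMass β a h k τ ≤ e' ^ 2 / c₀ := fun τ _ => by
    rw [← sq_abs]
    exact div_le_div₀ (sq_nonneg _) (pow_le_pow_left₀ (abs_nonneg _) (hp τ) 2) (Real.exp_pos _)
      (hlow τ)
  refine (Finset.sum_le_sum hterm).trans (le_of_eq ?_)
  rw [Finset.sum_const, Finset.card_univ, nsmul_eq_mul, mul_div_assoc]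

/-- Convergence of the mass functions in probability to product measures with finitely many
parameters implies convergence of the relative entropies. -/
theorem tendsto_measure_le_klDiv {β : ℝ} (hβ : 0 < β) {h : ℕ → Ω → ℝ}
    (h_int : ∀ i, Integrable (h i) P) {ι : Type*} [Fintype ι] (y : ι → ℝ) (k : ℕ)
    (J : ℕ → Ω → ι) {p : ℕ → Ω → Config k → ℝ} (hp : ∀ N ω τ, 0 ≤ p N ω τ)
    (hlim : ∀ ε : ℝ, 0 < ε → Tendsto (fun N => P {ω | ∃ τ : Config k,
      ε ≤ |p N ω τ - productMass β (y (J N ω)) (fun i => h i ω) k τ|}) atTop (𝓝 0))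
    {ε : ℝ≥0∞} (hε : 0 < ε) :
    Tendsto (fun N => P {ω | ε ≤ InformationTheory.klDiv (massMeasure (p N ω))
      (massMeasure (productMass β (y (J N ω)) (fun i => h i ω) k))}) atTop (𝓝 0) := by
  obtain ⟨e, he0, heε⟩ := ENNReal.lt_iff_exists_nnreal_btwn.1 hε
  have he0 : (0 : ℝ) < e := by exact_mod_cast he0
  rw [ENNReal.tendsto_nhds_zero]
  intro δ hδ
  have hδ2 : 0 < δ / 2 := ENNReal.half_pos hδ.ne'
  have hS : Integrable (fun ω => ∑ i : Fin k, |h i ω|) P :=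
    integrable_finsetSum _ fun i _ => (h_int i).abs
  -- Unbounded fields leave no deterministic lower bound on the masses. But the first `k` fields do
  -- not change with `N`, so one `A`, hence one bound `c₀`, serves all `N` off an event of
  -- probability `δ / 2`.
  obtain ⟨A, hA⟩ := (ENNReal.tendsto_nhds_zero.1 (tendsto_measure_ge_atTop hS fun ω =>
    Finset.sum_nonneg fun i _ => abs_nonneg _) _ hδ2).exists
  set Y := ∑ j, |y j|
  have hY : ∀ j, |y j| ≤ Y := fun j =>
    Finset.single_le_sum (f := fun j => |y j|) (fun j _ => abs_nonneg _) (Finset.mem_univ j)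
  set c₀ := Real.exp (-(k * (2 * √β * Y + Real.log 2) + 2 * β * A))
  obtain ⟨e', he', hee'⟩ : ∃ e' > 0, Fintype.card (Config k) * e' ^ 2 / c₀ < (e : ℝ) := by
    have h1 : Tendsto (fun e' : ℝ => Fintype.card (Config k) * e' ^ 2 / c₀) (𝓝[>] 0) (𝓝 0) := by
      have : Continuous fun e' : ℝ => Fintype.card (Config k) * e' ^ 2 / c₀ := by fun_prop
      simpa using (this.tendsto 0).mono_left nhdsWithin_le_nhds
    obtain ⟨e', h2, h3⟩ := ((h1.eventually_lt_const he0).and self_mem_nhdsWithin).exists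
    exact ⟨e', h3, h2⟩
  filter_upwards [ENNReal.tendsto_nhds_zero.1 (hlim e' he') _ hδ2] with N hN
  have hsub : {ω | ε ≤ InformationTheory.klDiv (massMeasure (p N ω))
      (massMeasure (productMass β (y (J N ω)) (fun i => h i ω) k))}
      ⊆ {ω | A ≤ ∑ i : Fin k, |h i ω|} ∪ {ω | ∃ τ : Config k,
        e' ≤ |p N ω τ - productMass β (y (J N ω)) (fun i => h i ω) k τ|} := by
    intro ω hω
    by_contra hcon
    simp only [Set.mem_union, Set.mem_ofPred_eq, not_or, not_exists, not_le] at hcon hω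
    have h1 := sum_sq_div_productMass_lt hβ.le (hY (J N ω)) hcon.1.le hee'
      fun τ => (hcon.2 τ).le
    have h2 := klDiv_massMeasure_le (hp N ω)
      (productMass_pos β (y (J N ω)) (fun i => h i ω) k)
    refine absurd (hω.trans h2) (not_le.2 (lt_of_le_of_lt ?_ heε))
    rw [← ENNReal.ofReal_coe_nnreal]
    exact ENNReal.ofReal_le_ofReal h1.le
  calc P _ ≤ _ := measure_mono hsub
    _ ≤ _ := measure_union_le _ _
    _ ≤ δ / 2 + δ / 2 := add_le_add hA hN
    _ = δ := ENNReal.add_halves δ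

end RelativeEntropyLimit

end RandomFieldCurieWeiss

/-! ### Choice of the index and conclusion. -/

theorem theorem3
    {Ω : Type*} [MeasurableSpace Ω] (P : Measure Ω) [IsProbabilityMeasure P]
    (β : ℝ) (hβ : 0 < β)
    -- the i.i.d. square-integrable random fields, with non-zero second moment
    (h : ℕ → Ω → ℝ) (h_meas : ∀ i, Measurable (h i))
    (h_indep : iIndepFun h P) (h_ident : ∀ i, IdentDistrib (h i) (h 0) P P)
    (h_sq : MemLp (h 0) 2 P) (h_ne : ∫ ω, (h 0 ω) ^ 2 ∂P ≠ 0)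
    -- the global maxima of `G` are exactly the distinct points `y 0, …, y s`, all non-degenerate
    (s : ℕ) (hs : 1 ≤ s) (y : Fin (s + 1) → ℝ) (y_inj : Function.Injective y)
    (y_max : ∀ x : ℝ,
      RandomFieldCurieWeiss.IsGlobalMax (RandomFieldCurieWeiss.freeEnergy β P (h 0)) x ↔
        ∃ j, y j = x)
    (y_nondeg : ∀ j,
      RandomFieldCurieWeiss.IsNondegenerate (RandomFieldCurieWeiss.freeEnergy β P (h 0)) (y j))
    (k : ℕ) :
    -- `J N` is a measurable function of the fields on the first `N` sites
    ∃ J : (N : ℕ) → (Fin N → ℝ) → Fin (s + 1), (∀ N, Measurable (J N)) ∧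
      (∀ τ : RandomFieldCurieWeiss.Config k,
        TendstoInMeasure P
          (fun N ω =>
            |RandomFieldCurieWeiss.marginal β (fun i => h i ω) N k τ
              - RandomFieldCurieWeiss.productMass β (y (J N (fun i => h i ω)))
                  (fun i => h i ω) k τ|)
          atTop (fun _ => 0)) ∧
      (∀ ε : ℝ≥0∞, 0 < ε →
        Tendsto
          (fun N => P {ω | ε ≤ InformationTheory.klDiv
            (RandomFieldCurieWeiss.massMeasure
              (RandomFieldCurieWeiss.marginal β (fun i => h i ω) N k))
            (RandomFieldCurieWeiss.massMeasure
              (RandomFieldCurieWeiss.productMass β (y (J N (fun i => h i ω)))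
                (fun i => h i ω) k))})
          atTop (𝓝 0)) := by
  classical
  -- This is `logDensity` at `y j`, written on `Fin N → ℝ` so that the maximising index is a
  -- measurable function of the first `N` fields.
  have hf : ∀ (N : ℕ) (j : Fin (s + 1)), Measurable fun x : Fin N → ℝ =>
      ∑ i, RandomFieldCurieWeiss.logCosh (√β * y j + β * x i) - N * (y j ^ 2 / 2) := fun N j => by
    have := RandomFieldCurieWeiss.continuous_logCosh.measurable
    fun_prop
  choose J hJ hJmax using fun N => RandomFieldCurieWeiss.exists_measurable_argmax _ (hf N)
  have hlim := fun (ε : ℝ) (hε : 0 < ε) =>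
    RandomFieldCurieWeiss.tendsto_measure_exists_le_abs_marginal_sub hβ h_meas h_indep h_ident h_sq
      h_ne y_inj y_max y_nondeg k (fun N ω => J N fun i => h i ω)
      (fun N ω i => by
        have := hJmax N (fun i => h i ω) i
        unfold RandomFieldCurieWeiss.logDensity
        linarith) hε
  refine ⟨J, hJ, fun τ => ?_, fun ε hε => ?_⟩
  · refine tendstoInMeasure_of_ne_top fun ε hε hε' => ?_
    refine tendsto_of_tendsto_of_tendsto_of_le_of_le tendsto_const_nhds
      (hlim ε.toReal (ENNReal.toReal_pos hε.ne' hε')) (fun _ => zero_le)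
      fun N => measure_mono fun ω hω => ⟨τ, ?_⟩
    have hω : ε ≤ edist _ _ := hω
    rwa [edist_dist, Real.dist_eq, sub_zero, abs_abs, ENNReal.le_ofReal_iff_toReal_le hε'
      (abs_nonneg _)] at hω
  · exact RandomFieldCurieWeiss.tendsto_measure_le_klDiv hβ
      (fun i => ((h_ident i).memLp_iff.2 h_sq).integrable one_le_two) y k
      (fun N ω => J N fun i => h i ω) (fun N ω => RandomFieldCurieWeiss.marginal_nonneg β _ N k)
      hlim hε
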